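/- Let $X=\{x_k\}_{k\in\mathbb Z}\subset\mathbb R$ be a strictly increasing sequence that is separated, i.e. $\inf_k|x_{k+1}-x_k|>0$. Suppose that $X$ has a sine-type generating function $S$ of exponential type $\pi b$. This means: the limit $$S(z)=z^{\delta_X}\lim_{r\to\infty}\prod_{0<|x_k|<r}\Big(1-\frac{z}{x_k}\Big)$$ exists for every $z\in\mathbb C$, where $\delta_X=1$ if $0\in X$ and $\delta_X=0$ otherwise; $S$ is entire of exponential type $\pi b<\infty$; and for every $\epsilon>0$ there are constants $C_1(\epsilon),C_2(\epsilon)>0$ with $C_1(\epsilon)\le e^{-\pi b|\mathrm{Im}\,z|}|S(z)|\le C_2(\epsilon)$ whenever $\mathrm{dist}(z,X)>\epsilon$. Let $\tilde x\in\mathbb C\setminus X$, and let $$PW_b^+=\Big\{f\ \text{entire}:\ \limsup_{r\to\infty}\int_{|z|=r}\big|z^{-2}e^{-\pi b|\mathrm{Im}\,z|}f(z)\big|\,|dz|=0\Big\}.$$ (i) If $f\in PW_b^+$, $a_k=f(x_k)$ and $\tilde a=f(\tilde x)$, then $$f(z)=\tilde a\,\frac{S(z)}{S(\tilde x)}+\sum_{k=-\infty}^{\infty}a_k\lim_{z_0\to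 z}\frac{S(z_0)}{S'(x_k)}\Big(\frac1{z_0-x_k}-\frac1{\tilde x-x_k}\Big),\qquad z\in\mathbb C,\qquad(\ast)$$ where the sum is the limit as $r\to\infty$ of the sums over $|x_k|<r$, and the convergence is uniform on compact subsets of $\mathbb C$. (ii) Conversely, for every $\tilde a\in\mathbb C$ and every bounded sequence $A=\{a_k\}_{k\in\mathbb Z}$ of complex numbers, the series $(\ast)$ converges uniformly on compact subsets of $\mathbb C$ (irrespective of the order of summation), and its sum $f$ lies in $PW_b^+$ and satisfies $f(x_k)=a_k$ for all $k$, $f(\tilde x)=\tilde a$, and $$|f(z)|\le C\,\max(\|A\|_{\ell^\infty},|\tilde a|)\,e^{\pi b|\mathrm{Im}\,z|}\,\big(1+\max(\log|z|,0)\big),\qquad z\in\mathbb C,$$ with a constant $C$ that does not depend on $A$ and $\tilde a$. -/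

import Mathlib

open Filter Topology

/-- The separation constant `λ(X) = inf_k |x_{k+1} - x_k|` of a sequence of real points. -/
noncomputable def separationConstant (x : ℤ → ℝ) : ℝ :=
  ⨅ k : ℤ, |x (k + 1) - x k|

/-- An increasing bi-infinite sequence of real points with positive separation constant. -/
structure IsSeparatedSeq (x : ℤ → ℝ) : Prop where
  strictMono : StrictMono x
  separationConstant_pos : 0 < separationConstant x

/-- `X`, viewed as a subset of the complex plane. -/
def pointSet (x : ℤ → ℝ) : Set ℂ :=
  Set.range fun k : ℤ => (x k : ℂ)

open Classical in
/-- The partial product `z^δ ∏_{0 < |x_k| < r} (1 - z / x_k)`, where `δ = 1` if `0 ∈ X` and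
`δ = 0` otherwise. For a separated sequence only finitely many `k` occur. -/
noncomputable def genPartialProd (x : ℤ → ℝ) (r : ℝ) (z : ℂ) : ℂ :=
  z ^ (if ∃ k, x k = 0 then 1 else 0 : ℕ) *
    ∏ᶠ k ∈ {k : ℤ | 0 < |x k| ∧ |x k| < r}, (1 - z / (x k : ℂ))

/-- The product converges, and `S` is the generating function of `X`. -/
def IsGeneratingFunction (x : ℤ → ℝ) (S : ℂ → ℂ) : Prop :=
  ∀ z : ℂ, Tendsto (fun r : ℝ => genPartialProd x r z) atTop (𝓝 (S z))

/-- `f` is entire of (finite) exponential type equal to `σ`. -/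
def HasExponentialType (f : ℂ → ℂ) (σ : ℝ) : Prop :=
  Differentiable ℂ f ∧
    IsGLB {β : ℝ | ∃ C : ℝ, ∀ z : ℂ, ‖f z‖ ≤ C * Real.exp (β * ‖z‖)} σ

/-- `S` is the generating function of `X`, it is sine-type, and its type is `π b`. -/
structure IsSineTypeGenerating (x : ℤ → ℝ) (S : ℂ → ℂ) (b : ℝ) : Prop where
  generating : IsGeneratingFunction x S
  type_eq : HasExponentialType S (Real.pi * b)
  bounds : ∀ ε : ℝ, 0 < ε → ∃ C₁ C₂ : ℝ, 0 < C₁ ∧ 0 < C₂ ∧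
    ∀ z : ℂ, ε < Metric.infDist z (pointSet x) →
      C₁ ≤ Real.exp (-(Real.pi * b * |z.im|)) * ‖S z‖ ∧
      Real.exp (-(Real.pi * b * |z.im|)) * ‖S z‖ ≤ C₂

/-- The arc-length integral `∫_{|z| = r} |z^{-2} e^{-π b |Im z|} f(z)| |dz|`, for `r > 0`. -/
noncomputable def circleGrowth (b : ℝ) (f : ℂ → ℂ) (r : ℝ) : ℝ :=
  ∫ θ in (0 : ℝ)..(2 * Real.pi),
    (‖circleMap 0 r θ‖ ^ 2)⁻¹ * Real.exp (-(Real.pi * b * |(circleMap 0 r θ).im|)) *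
      ‖f (circleMap 0 r θ)‖ * r

/-- The space `PW_b^+` of the entire functions whose weighted circle integrals tend to `0`. -/
def PWPlus (b : ℝ) : Set (ℂ → ℂ) :=
  {f | Differentiable ℂ f ∧ Tendsto (circleGrowth b f) atTop (𝓝 0)}

/-- `lim_{z₀ → z} S(z₀) / S'(x_k) * (1 / (z₀ - x_k) - 1 / (x̃ - x_k))`. The limit only matters
at `z = x_k`, where the function of `z₀` has a removable singularity. -/
noncomputable def interpKernel (x : ℤ → ℝ) (S : ℂ → ℂ) (xt : ℂ) (k : ℤ) (z : ℂ) : ℂ :=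
  limUnder (𝓝[≠] z) fun z₀ : ℂ =>
    S z₀ / deriv S (x k : ℂ) * (1 / (z₀ - (x k : ℂ)) - 1 / (xt - (x k : ℂ)))

/-- The part of the series `ã S(z) / S(x̃) + ∑_k a_k lim_{z₀ → z} …` with the indices `k` in a
finite set `s`. -/
noncomputable def interpPartialSum (x : ℤ → ℝ) (S : ℂ → ℂ) (xt ta : ℂ) (a : ℤ → ℂ)
    (s : Set ℤ) (z : ℂ) : ℂ :=
  ta * (S z / S xt) + ∑ᶠ k ∈ s, a k * interpKernel x S xt k z

/-! ### Separated sequences -/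

/-! The zeros of `S` are exactly the points of `X`, and they are uniformly simple: `|S'(x_k)|` is
bounded below in `k` (`exists_le_norm_deriv`), by comparing the products at `x_k + i` and `x_k + it`
factor by factor and letting `t → 0`.

For (ii), the `k`-th kernel is then at most a constant times `e^{πb|Im z|} |z - x̃| / ((1 + |z -
x_k|)(1 + |x̃ - x_k|))`. On compact sets this is summable like `1/k²`, which gives unconditional
uniform convergence. Globally, the sum over a separated sequence costs only a logarithm of `|z -
x̃|` (`exists_sum_norm_interpKernel_le`), and logarithmic growth is enough for membership in
`PW_b^+`.

For (i), the remainder of the partial sum over `|x_k| < ρ` is `S(z)` times a Cauchy integral of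
`f/S` over `|ζ| = ρ` against `1/(ζ - z) - 1/(ζ - x̃) = O(ρ⁻²)` (`sub_interpPartialSum_eq_integral`).
If the circle stays away from `X`, then `|S| ≳ e^{πb|Im ζ|}` on it, and the remainder is bounded by
the weighted circle integral defining `PW_b^+`. For arbitrary `r` such a circle need not exist
between consecutive moduli `|x_k|`, since `x_j` and `-x_k` may nearly coincide. So `r` is enclosed
between two good radii, and the at most two terms in the annulus are bounded one at a time
(`norm_mul_interpKernel_le`) by applying the remainder estimate to `f` times a linear factor that
kills the other term. -/

lemma IsSeparatedSeq.sep_mul_abs_le {x : ℤ → ℝ} (hx : IsSeparatedSeq x) (j k : ℤ) :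
    separationConstant x * |((j - k : ℤ) : ℝ)| ≤ |x j - x k| := by
  have hstep : ∀ k, separationConstant x ≤ x (k + 1) - x k := fun k => by
    have h : separationConstant x ≤ |x (k + 1) - x k| :=
      ciInf_le ⟨0, by rintro _ ⟨k, rfl⟩; exact abs_nonneg _⟩ k
    rwa [abs_of_pos (sub_pos.2 (hx.strictMono (by omega)))] at h
  have hn : ∀ (n : ℕ) (k : ℤ), separationConstant x * n ≤ x (k + n) - x k := by
    intro n k
    induction n with
    | zero => simp
    | succ n ih =>
      have := hstep (k + n)
      push_cast
      rw [← add_assoc]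
      linarith
  rcases le_total k j with h | h
  · obtain ⟨n, rfl⟩ := Int.le.dest h
    have := hn n k
    simp only [add_sub_cancel_left, Int.cast_natCast, Nat.abs_cast]
    exact this.trans (le_abs_self _)
  · obtain ⟨n, rfl⟩ := Int.le.dest h
    have := hn n j
    rw [abs_sub_comm (x j)]
    have e : j - (j + (n : ℤ)) = -(n : ℤ) := by ring
    rw [e]
    push_cast
    rw [abs_neg, Nat.abs_cast]
    exact this.trans (le_abs_self _)

lemma IsSeparatedSeq.sep_le {x : ℤ → ℝ} (hx : IsSeparatedSeq x) {j k : ℤ} (h : j ≠ k) :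
    separationConstant x ≤ |x j - x k| := by
  refine le_trans ?_ (hx.sep_mul_abs_le j k)
  have : (1 : ℝ) ≤ |((j - k : ℤ) : ℝ)| := by
    rw [← Int.cast_abs]
    exact_mod_cast Int.one_le_abs (sub_ne_zero.2 h)
  nlinarith [hx.separationConstant_pos]

lemma IsSeparatedSeq.finite_abs_lt {x : ℤ → ℝ} (hx : IsSeparatedSeq x) (r : ℝ) :
    {k : ℤ | |x k| < r}.Finite := by
  have hpos := hx.separationConstant_pos
  obtain ⟨N, hN⟩ := exists_nat_gt ((r + |x 0|) / separationConstant x)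
  refine (Set.finite_Icc (-(N : ℤ)) N).subset fun k hk => ?_
  have h1 := hx.sep_mul_abs_le k 0
  have h2 : |x k - x 0| ≤ |x k| + |x 0| := abs_sub _ _
  have h3 : |x k| < r := hk
  rw [div_lt_iff₀ hpos] at hN
  have h4 : |((k - 0 : ℤ) : ℝ)| < N := by
    by_contra! h
    nlinarith
  rw [sub_zero, ← Int.cast_abs] at h4
  have h5 : |k| < (N : ℤ) := by exact_mod_cast h4
  rw [abs_lt] at h5
  exact ⟨h5.1.le, h5.2.le⟩

lemma IsSeparatedSeq.isClosed_pointSet {x : ℤ → ℝ} (hx : IsSeparatedSeq x) :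
    IsClosed (pointSet x) := by
  refine Metric.isClosed_of_pairwise_le_dist hx.separationConstant_pos ?_
  rintro _ ⟨j, rfl⟩ _ ⟨k, rfl⟩ h
  have hjk : j ≠ k := fun e => h (by rw [e])
  simp only [Complex.dist_eq]
  rw [← Complex.ofReal_sub, Complex.norm_real, Real.norm_eq_abs]
  exact hx.sep_le hjk

lemma pointSet_nonempty (x : ℤ → ℝ) : (pointSet x).Nonempty := ⟨_, 0, rfl⟩

lemma ofReal_mem_pointSet (x : ℤ → ℝ) (k : ℤ) : (x k : ℂ) ∈ pointSet x := ⟨k, rfl⟩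

/-! ### The generating function and its zeros -/

open Classical in
-- In this form the normalising constant is common to all `z`, so values of one partial product at
-- two points are compared factor by factor.
lemma exists_genPartialProd_eq {x : ℤ → ℝ} (hx : IsSeparatedSeq x) {r : ℝ} (hr : 0 < r) :
    ∃ c : ℂ, ∀ z, genPartialProd x r z =
      c * ∏ j ∈ (hx.finite_abs_lt r).toFinset, (z - (x j : ℂ)) := by
  set F := (hx.finite_abs_lt r).toFinset with hF
  refine ⟨∏ j ∈ F.filter (fun j => x j ≠ 0), (-(x j : ℂ)⁻¹), fun z => ?_⟩
  have hset : {k : ℤ | 0 < |x k| ∧ |x k| < r} = ↑(F.filter (fun j => x j ≠ 0)) := by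
    ext k; simp [hF, and_comm]
  have h0 : ∏ j ∈ F.filter (fun j => ¬ x j ≠ 0), (z - (x j : ℂ)) =
      z ^ (if ∃ k, x k = 0 then 1 else 0 : ℕ) := by
    split_ifs with h
    · obtain ⟨k, hk⟩ := h
      have : F.filter (fun j => ¬ x j ≠ 0) = {k} := by
        ext j
        simp only [hF, Finset.mem_filter, Set.Finite.mem_toFinset, Set.mem_ofPred_eq, not_not,
          Finset.mem_singleton]
        refine ⟨fun h => hx.strictMono.injective (h.2.trans hk.symm), ?_⟩
        rintro rfl
        simp [hk, hr]
      rw [this]; simp [hk]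
    · have : F.filter (fun j => ¬ x j ≠ 0) = ∅ := by
        ext j
        simp only [Finset.mem_filter, not_not, Finset.notMem_empty, iff_false, not_and]
        exact fun _ e => h ⟨j, e⟩
      rw [this]; simp
  rw [genPartialProd, hset, finprod_mem_coe_finset, ← h0,
    ← Finset.prod_filter_mul_prod_filter_not F (fun j => x j ≠ 0) (fun j => z - (x j : ℂ)),
    ← mul_assoc, ← Finset.prod_mul_distrib, mul_comm]
  congr 1
  refine Finset.prod_congr rfl fun j hj => ?_
  have hj0 : (x j : ℂ) ≠ 0 := by exact_mod_cast (Finset.mem_filter.1 hj).2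
  field_simp
  ring

lemma IsGeneratingFunction.apply_eq_zero {x : ℤ → ℝ} (hx : IsSeparatedSeq x) {S : ℂ → ℂ}
    (hS : IsGeneratingFunction x S) (k : ℤ) : S (x k : ℂ) = 0 := by
  refine tendsto_nhds_unique (hS (x k : ℂ)) (tendsto_const_nhds.congr' ?_)
  filter_upwards [eventually_gt_atTop |x k|] with r hr
  obtain ⟨c, hc⟩ := exists_genPartialProd_eq hx ((abs_nonneg _).trans_lt hr)
  rw [hc, Finset.prod_eq_zero (i := k) (by simpa using hr) (sub_self (x k : ℂ)), mul_zero]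

lemma IsSineTypeGenerating.differentiable {x : ℤ → ℝ} {S : ℂ → ℂ} {b : ℝ}
    (hS : IsSineTypeGenerating x S b) : Differentiable ℂ S := hS.type_eq.1

lemma IsSineTypeGenerating.ne_zero {x : ℤ → ℝ} (hx : IsSeparatedSeq x) {S : ℂ → ℂ} {b : ℝ}
    (hS : IsSineTypeGenerating x S b) {z : ℂ} (hz : z ∉ pointSet x) : S z ≠ 0 := by
  have h := (hx.isClosed_pointSet.notMem_iff_infDist_pos (pointSet_nonempty x)).1 hz
  obtain ⟨C₁, C₂, h1, -, hb⟩ := hS.bounds _ (half_pos h)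
  intro h0
  have := (hb z (half_lt_self h)).1
  rw [h0, norm_zero, mul_zero] at this
  linarith

/-- Moving a point of the sequence upwards changes the distance to the other points of the
sequence only by a bounded factor. -/
lemma norm_add_I_le (d t : ℝ) (hd : d ≠ 0) :
    ‖(d : ℂ) + Complex.I‖ ≤ ‖(d : ℂ) + t * Complex.I‖ * Real.exp ((d ^ 2)⁻¹) := by
  have hd2 : 0 < d ^ 2 := by positivity
  have h1 : |d| ≤ ‖(d : ℂ) + t * Complex.I‖ := by
    have := Complex.abs_re_le_norm ((d : ℂ) + t * Complex.I)
    simpa using this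
  have h2 : ‖(d : ℂ) + Complex.I‖ ≤ |d| * (1 + (d ^ 2)⁻¹) := by
    have := Complex.norm_add_mul_I d 1
    rw [Complex.ofReal_one, one_mul] at this
    rw [this]
    apply Real.sqrt_le_iff.2 ⟨by positivity, ?_⟩
    rw [mul_pow, sq_abs]
    have : d ^ 2 * (1 + (d ^ 2)⁻¹) ^ 2 = d ^ 2 + 2 + (d ^ 2)⁻¹ := by field_simp; ring
    rw [this]
    have : 0 < (d ^ 2)⁻¹ := by positivity
    linarith
  calc _ ≤ |d| * (1 + (d ^ 2)⁻¹) := h2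
    _ ≤ _ := by
      gcongr
      linarith [Real.add_one_le_exp ((d ^ 2)⁻¹)]

/-- The factor `j = k` is `i` against `it`, which accounts for `t`. Every other factor costs at most
`exp(1/(x_k - x_j)²)`, and separation bounds the sum of these exponents uniformly in `k` and `r`. -/
lemma exists_le_norm_genPartialProd {x : ℤ → ℝ} (hx : IsSeparatedSeq x) :
    ∃ E : ℝ, 0 < E ∧ ∀ (k : ℤ) (r t : ℝ), |x k| < r → 0 < t →
      t * ‖genPartialProd x r (x k + Complex.I)‖ ≤
        E * ‖genPartialProd x r (x k + t * Complex.I)‖ := by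
  have hpos := hx.separationConstant_pos
  -- The term `n = 0` is `0⁻¹ = 0`, so summing over all of `ℤ` is harmless.
  have hsum : Summable fun n : ℤ => ((n : ℝ) ^ 2)⁻¹ := by
    simpa using (Real.summable_one_div_int_pow (p := 2)).2 (by norm_num)
  set T := ∑' n : ℤ, ((n : ℝ) ^ 2)⁻¹ with hT
  refine ⟨Real.exp ((separationConstant x ^ 2)⁻¹ * T), Real.exp_pos _, fun k r t hr ht => ?_⟩
  obtain ⟨c, hc⟩ := exists_genPartialProd_eq hx ((abs_nonneg _).trans_lt hr)
  set F := (hx.finite_abs_lt r).toFinset with hF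
  have hk : k ∈ F := by simpa [hF] using hr
  rw [hc, hc, ← Finset.mul_prod_erase F _ hk, ← Finset.mul_prod_erase F _ hk]
  simp only [add_sub_cancel_left, norm_mul, Complex.norm_I, one_mul, Complex.norm_real,
    Real.norm_eq_abs, abs_of_pos ht, mul_one, norm_prod]
  have key : ∏ j ∈ F.erase k, ‖(x k : ℂ) + Complex.I - x j‖ ≤
      (∏ j ∈ F.erase k, ‖(x k : ℂ) + t * Complex.I - x j‖) *
        Real.exp ((separationConstant x ^ 2)⁻¹ * T) := by
    calc _ ≤ ∏ j ∈ F.erase k, ‖(x k : ℂ) + t * Complex.I - x j‖ *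
          Real.exp ((separationConstant x ^ 2)⁻¹ * (((k - j : ℤ) : ℝ) ^ 2)⁻¹) := by
          refine Finset.prod_le_prod (fun _ _ => norm_nonneg _) fun j hj => ?_
          have hjk : k ≠ j := (Finset.ne_of_mem_erase hj).symm
          have hd : x k - x j ≠ 0 := sub_ne_zero.2 fun e => hjk (hx.strictMono.injective e)
          have h := norm_add_I_le (x k - x j) t hd
          have e1 : (x k : ℂ) + Complex.I - x j = ((x k - x j : ℝ) : ℂ) + Complex.I := by
            push_cast; ring
          have e2 : (x k : ℂ) + t * Complex.I - x j = ((x k - x j : ℝ) : ℂ) + t * Complex.I := by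
            push_cast; ring
          rw [e1, e2]
          refine h.trans ?_
          gcongr
          rw [← mul_inv, ← mul_pow]
          have hkj : ((k - j : ℤ) : ℝ) ≠ 0 := by exact_mod_cast sub_ne_zero.2 hjk
          have h3 := hx.sep_mul_abs_le k j
          rw [← sq_abs (x k - x j), ← sq_abs (_ * _), abs_mul, abs_of_pos hpos]
          gcongr
      _ = (∏ j ∈ F.erase k, ‖(x k : ℂ) + t * Complex.I - x j‖) *
          Real.exp ((separationConstant x ^ 2)⁻¹ *
            ∑ j ∈ F.erase k, (((k - j : ℤ) : ℝ) ^ 2)⁻¹) := by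
          rw [Finset.prod_mul_distrib, ← Real.exp_sum, Finset.mul_sum]
      _ ≤ _ := by
          gcongr
          have hs := (Equiv.subLeft k).summable_iff.2 hsum
          have e : ∑' j : ℤ, (((k - j : ℤ) : ℝ) ^ 2)⁻¹ = T :=
            (Equiv.subLeft k).tsum_eq fun n : ℤ => ((n : ℝ) ^ 2)⁻¹
          rw [← e]
          exact hs.sum_le_tsum _ fun _ _ => by positivity
  calc t * (‖c‖ * ∏ j ∈ F.erase k, ‖(x k : ℂ) + Complex.I - x j‖)
      ≤ t * (‖c‖ * ((∏ j ∈ F.erase k, ‖(x k : ℂ) + t * Complex.I - x j‖) *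
        Real.exp ((separationConstant x ^ 2)⁻¹ * T))) := by gcongr
    _ = _ := by ring

/-- After `r → ∞`, the product comparison bounds the vertical difference quotient of `S` at `x_k`
below by `|S(x_k + i)| / E`. The point `x_k + i` is at distance at least 1 from `X`, so the
sine-type lower bound applies there. -/
lemma IsSineTypeGenerating.exists_le_norm_deriv {x : ℤ → ℝ} (hx : IsSeparatedSeq x)
    {S : ℂ → ℂ} {b : ℝ} (hS : IsSineTypeGenerating x S b) :
    ∃ c : ℝ, 0 < c ∧ ∀ k : ℤ, c ≤ ‖deriv S (x k : ℂ)‖ := by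
  obtain ⟨E, hE, h⟩ := exists_le_norm_genPartialProd hx
  obtain ⟨C₁, C₂, h1, -, hb⟩ := hS.bounds (1 / 2) (by norm_num)
  refine ⟨C₁ * Real.exp (Real.pi * b) / E, by positivity, fun k => ?_⟩
  have hlow : C₁ * Real.exp (Real.pi * b) ≤ ‖S (x k + Complex.I)‖ := by
    have hd : 1 / 2 < Metric.infDist ((x k : ℂ) + Complex.I) (pointSet x) := by
      refine lt_of_lt_of_le (by norm_num : (1 / 2 : ℝ) < 1)
        ((Metric.le_infDist (pointSet_nonempty x)).2 ?_)
      rintro _ ⟨j, rfl⟩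
      have := Complex.abs_im_le_norm ((x k : ℂ) + Complex.I - x j)
      simpa [Complex.dist_eq] using this
    have := (hb _ hd).1
    simp only [Complex.add_im, Complex.ofReal_im, Complex.I_im, zero_add, abs_one, mul_one] at this
    rw [Real.exp_neg, inv_mul_eq_div, le_div_iff₀ (Real.exp_pos _)] at this
    exact this
  have hS0 := hS.generating.apply_eq_zero hx k
  have hlim : ∀ t : ℝ, 0 < t →
      ‖S (x k + Complex.I)‖ / E ≤ ‖(t : ℂ)⁻¹ • (S (x k + t * Complex.I) - S (x k))‖ := by
    intro t ht
    have := le_of_tendsto_of_tendsto ((hS.generating (x k + Complex.I)).norm.const_mul t)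
      ((hS.generating (x k + t * Complex.I)).norm.const_mul E)
      (by filter_upwards [eventually_gt_atTop |x k|] with r hr using h k r t hr ht)
    rw [hS0, sub_zero, norm_smul, norm_inv, Complex.norm_real, Real.norm_eq_abs, abs_of_pos ht,
      div_le_iff₀ hE, mul_assoc, inv_mul_eq_div, le_div_iff₀ ht]
    linarith
  have hderiv : HasDerivAt (fun t : ℝ => S (x k + t * Complex.I))
      (deriv S (x k) * Complex.I) 0 := by
    have h2 : HasDerivAt (fun t : ℝ => (x k : ℂ) + t * Complex.I) Complex.I 0 := by
      simpa using ((Complex.ofRealCLM.hasDerivAt (x := (0 : ℝ))).mul_const Complex.I).const_add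
        (x k : ℂ)
    have h3 : HasDerivAt S (deriv S (x k)) ((fun t : ℝ => (x k : ℂ) + t * Complex.I) 0) := by
      simpa using (hS.differentiable (x k)).hasDerivAt
    exact HasDerivAt.comp (0 : ℝ) h3 h2
  have h4 := (hasDerivAt_iff_tendsto_slope_zero.1 hderiv).norm
  have h5 : ‖S (x k + Complex.I)‖ / E ≤ ‖deriv S (x k) * Complex.I‖ := by
    refine ge_of_tendsto (h4.mono_left (nhdsGT_le_nhdsNE 0)) ?_
    filter_upwards [self_mem_nhdsWithin] with t ht
    have := hlim t ht
    simpa [Complex.real_smul] using this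
  rw [norm_mul, Complex.norm_I, mul_one] at h5
  exact le_trans (by gcongr) h5

/-! ### The interpolation kernels -/

lemma dslope_eq_div {S : ℂ → ℂ} {c z : ℂ} (hc : S c = 0) (hz : z ≠ c) :
    dslope S c z = S z / (z - c) := by
  rw [dslope_of_ne _ hz, slope_def_field, hc, sub_zero]

lemma sub_mul_dslope {S : ℂ → ℂ} {c : ℂ} (hc : S c = 0) (z : ℂ) :
    (z - c) * dslope S c z = S z := by
  have := sub_smul_dslope S c z
  rwa [hc, sub_zero, smul_eq_mul] at this

lemma differentiable_dslope {S : ℂ → ℂ} (hS : Differentiable ℂ S) (c : ℂ) :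
    Differentiable ℂ (dslope S c) := by
  rw [← differentiableOn_univ, Complex.differentiableOn_dslope univ_mem]
  exact hS.differentiableOn

lemma sub_ofReal_ne_zero {x : ℤ → ℝ} {z : ℂ} (hz : z ∉ pointSet x) (k : ℤ) :
    z - (x k : ℂ) ≠ 0 := sub_ne_zero.2 fun e => hz ⟨k, e.symm⟩

/-- Since `S(x_k) = 0`, `dslope` is the continuous extension of `S(z)/(z - x_k)`, so the limit is a
value. Combining the two fractions produces the factor `x̃ - z`. -/
lemma interpKernel_eq {x : ℤ → ℝ} (hx : IsSeparatedSeq x) {S : ℂ → ℂ} {b : ℝ}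
    (hS : IsSineTypeGenerating x S b) {xt : ℂ} (hxt : xt ∉ pointSet x) (k : ℤ) (z : ℂ) :
    interpKernel x S xt k z =
      dslope S (x k) z * (xt - z) / (xt - x k) / deriv S (x k) := by
  have hS0 := hS.generating.apply_eq_zero hx k
  have hne := sub_ofReal_ne_zero hxt k
  refine Tendsto.limUnder_eq ?_
  have hcont : Continuous fun z =>
      dslope S (x k) z * (xt - z) / (xt - x k) / deriv S (x k) := by
    have := (differentiable_dslope hS.differentiable (x k)).continuous
    fun_prop
  refine (hcont.tendsto z |>.mono_left nhdsWithin_le_nhds).congr' ?_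
  have hev : ∀ᶠ w in 𝓝[≠] z, w ≠ (x k : ℂ) := by
    by_cases h : z = x k
    · rw [← h]; exact self_mem_nhdsWithin
    · exact nhdsWithin_le_nhds (isOpen_ne.mem_nhds h)
  filter_upwards [hev] with w hw
  have hw' : w - (x k : ℂ) ≠ 0 := sub_ne_zero.2 hw
  rw [dslope_eq_div hS0 hw]
  field_simp
  ring

lemma interpKernel_differentiable {x : ℤ → ℝ} (hx : IsSeparatedSeq x) {S : ℂ → ℂ} {b : ℝ}
    (hS : IsSineTypeGenerating x S b) {xt : ℂ} (hxt : xt ∉ pointSet x) (k : ℤ) :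
    Differentiable ℂ (interpKernel x S xt k) := by
  have h := differentiable_dslope hS.differentiable (x k)
  rw [funext (interpKernel_eq hx hS hxt k)]
  fun_prop

lemma interpKernel_base {x : ℤ → ℝ} (hx : IsSeparatedSeq x) {S : ℂ → ℂ} {b : ℝ}
    (hS : IsSineTypeGenerating x S b) {xt : ℂ} (hxt : xt ∉ pointSet x) (k : ℤ) :
    interpKernel x S xt k xt = 0 := by
  simp [interpKernel_eq hx hS hxt]

lemma IsSineTypeGenerating.deriv_ne_zero {x : ℤ → ℝ} (hx : IsSeparatedSeq x) {S : ℂ → ℂ} {b : ℝ}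
    (hS : IsSineTypeGenerating x S b) (k : ℤ) : deriv S (x k) ≠ 0 := by
  obtain ⟨c, hc, h⟩ := hS.exists_le_norm_deriv hx
  exact norm_pos_iff.1 (hc.trans_le (h k))

lemma interpKernel_self {x : ℤ → ℝ} (hx : IsSeparatedSeq x) {S : ℂ → ℂ} {b : ℝ}
    (hS : IsSineTypeGenerating x S b) {xt : ℂ} (hxt : xt ∉ pointSet x) (k : ℤ) :
    interpKernel x S xt k (x k) = 1 := by
  have h1 := sub_ofReal_ne_zero hxt k
  have h2 := hS.deriv_ne_zero hx k
  rw [interpKernel_eq hx hS hxt, dslope_same]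
  field_simp

lemma interpKernel_of_ne {x : ℤ → ℝ} (hx : IsSeparatedSeq x) {S : ℂ → ℂ} {b : ℝ}
    (hS : IsSineTypeGenerating x S b) {xt : ℂ} (hxt : xt ∉ pointSet x) {k j : ℤ} (h : j ≠ k) :
    interpKernel x S xt k (x j) = 0 := by
  have hne : (x j : ℂ) ≠ x k := fun e => h (hx.strictMono.injective (by exact_mod_cast e))
  rw [interpKernel_eq hx hS hxt, dslope_eq_div (hS.generating.apply_eq_zero hx k) hne,
    hS.generating.apply_eq_zero hx j]
  simp

/-! ### Logarithmic bounds for sums over a separated sequence -/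

/-- Split at `N = ⌊T⌋`: the harmonic sum up to `N` is at most `1 + log T`, and the tail `T ∑ 1/i²`
beyond `N` is at most `2T/(N + 1) ≤ 2`. -/
lemma sum_nat_min_inv_le {T : ℝ} (hT : 1 ≤ T) (u : Finset ℕ) :
    ∑ n ∈ u, min ((1 + (n : ℝ))⁻¹) (T * ((1 + (n : ℝ))⁻¹) ^ 2) ≤ 3 + Real.log T := by
  set N := ⌊T⌋₊ with hN
  have hN1 : 1 ≤ N := Nat.le_floor (by simpa using hT)
  have hNT : (N : ℝ) ≤ T := Nat.floor_le (by linarith)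
  have hTN : T < N + 1 := Nat.lt_floor_add_one T
  set m := u.sup id with hm
  set φ : ℕ → ℝ := fun i => min ((i : ℝ)⁻¹) (T * ((i : ℝ)⁻¹) ^ 2) with hφ
  have hφ0 : ∀ i, 0 ≤ φ i := fun i => le_min (by positivity) (by positivity)
  have hinj : Set.InjOn Nat.succ (u : Set ℕ) := Nat.succ_injective.injOn
  have h1 : ∑ n ∈ u, min ((1 + (n : ℝ))⁻¹) (T * ((1 + (n : ℝ))⁻¹) ^ 2) =
      ∑ i ∈ u.image Nat.succ, φ i := by
    rw [Finset.sum_image hinj]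
    refine Finset.sum_congr rfl fun n _ => ?_
    simp only [hφ, Nat.cast_succ, add_comm]
  have hsub : u.image Nat.succ ⊆ Finset.Icc 1 N ∪ Finset.Ioo N (m + 2) := by
    intro i hi
    obtain ⟨n, hn, rfl⟩ := Finset.mem_image.1 hi
    have : n ≤ m := Finset.le_sup (f := id) hn
    simp only [Finset.mem_union, Finset.mem_Icc, Finset.mem_Ioo]
    omega
  have hdisj : Disjoint (Finset.Icc 1 N) (Finset.Ioo N (m + 2)) := by
    rw [Finset.disjoint_left]
    intro i hi hi'
    simp only [Finset.mem_Icc, Finset.mem_Ioo] at hi hi'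
    omega
  have h2 : ∑ i ∈ Finset.Icc 1 N, φ i ≤ 1 + Real.log T := by
    calc ∑ i ∈ Finset.Icc 1 N, φ i ≤ ∑ i ∈ Finset.Icc 1 N, ((i : ℝ))⁻¹ :=
          Finset.sum_le_sum fun i _ => min_le_left _ _
      _ = (harmonic N : ℝ) := by rw [harmonic_eq_sum_Icc]; push_cast; rfl
      _ ≤ 1 + Real.log N := harmonic_le_one_add_log N
      _ ≤ 1 + Real.log T := by gcongr
  have h3 : ∑ i ∈ Finset.Ioo N (m + 2), φ i ≤ 2 := by
    calc ∑ i ∈ Finset.Ioo N (m + 2), φ i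
        ≤ ∑ i ∈ Finset.Ioo N (m + 2), T * ((i : ℝ) ^ 2)⁻¹ :=
          Finset.sum_le_sum fun i _ => (min_le_right _ _).trans (by rw [inv_pow])
      _ = T * ∑ i ∈ Finset.Ioo N (m + 2), ((i : ℝ) ^ 2)⁻¹ := by rw [Finset.mul_sum]
      _ ≤ (N + 1) * (2 / (N + 1)) := by
          gcongr
          exact sum_Ioo_inv_sq_le N (m + 2)
      _ = 2 := by field_simp
  rw [h1]
  calc ∑ i ∈ u.image Nat.succ, φ i ≤ ∑ i ∈ Finset.Icc 1 N ∪ Finset.Ioo N (m + 2), φ i :=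
        Finset.sum_le_sum_of_subset_of_nonneg hsub fun i _ _ => hφ0 i
    _ = _ := Finset.sum_union hdisj
    _ ≤ _ := by linarith

lemma sum_int_min_inv_le {T : ℝ} (hT : 1 ≤ T) (s : Finset ℤ) :
    ∑ j ∈ s, min ((1 + |(j : ℝ)|)⁻¹) (T * ((1 + |(j : ℝ)|)⁻¹) ^ 2) ≤ 2 * (3 + Real.log T) := by
  set ψ : ℕ → ℝ := fun n => min ((1 + (n : ℝ))⁻¹) (T * ((1 + (n : ℝ))⁻¹) ^ 2) with hψ
  have key : ∀ P : Finset ℤ, Set.InjOn Int.natAbs (P : Set ℤ) →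
      ∑ j ∈ P, ψ j.natAbs ≤ 3 + Real.log T := by
    intro P hP
    rw [← Finset.sum_image (f := ψ) hP]
    exact sum_nat_min_inv_le hT _
  have e : ∀ j : ℤ, min ((1 + |(j : ℝ)|)⁻¹) (T * ((1 + |(j : ℝ)|)⁻¹) ^ 2) = ψ j.natAbs := by
    intro j
    simp only [hψ, Nat.cast_natAbs, Int.cast_abs]
  simp only [e]
  rw [← Finset.sum_filter_add_sum_filter_not s (fun j => 0 ≤ j)]
  have h1 := key (s.filter (fun j => 0 ≤ j)) (by
    intro i hi j hj h
    simp only [Finset.coe_filter, Set.mem_ofPred_eq] at hi hj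
    omega)
  have h2 := key (s.filter (fun j => ¬ 0 ≤ j)) (by
    intro i hi j hj h
    simp only [Finset.coe_filter, Set.mem_ofPred_eq] at hi hj
    omega)
  linarith

lemma IsSeparatedSeq.exists_le_of_real {x : ℤ → ℝ} (hx : IsSeparatedSeq x) :
    ∃ c : ℝ, 0 < c ∧ c ≤ 1 ∧ ∀ y : ℝ, ∃ n : ℤ, ∀ k : ℤ,
      c * (1 + |((k - n : ℤ) : ℝ)|) ≤ 1 + |y - x k| := by
  have hpos := hx.separationConstant_pos
  set l := separationConstant x with hl
  -- The index `n` will be the last one with `x n ≤ y`. To its right the gap `|y - x k|` is only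
  -- known to exceed `l (d - 1)`, where `d = k - n`; writing `1 + d = (d - 1) + 2`, the half makes
  -- the leftover `2` cost at most 1.
  refine ⟨min 1 l / 2, by positivity, by linarith [min_le_left 1 l], fun y => ?_⟩
  have hm0 : 0 < min 1 l := by positivity
  have hm1 : min 1 l ≤ 1 := min_le_left _ _
  have hm2 : min 1 l ≤ l := min_le_right _ _
  have hlarge : ∃ m : ℤ, ∀ k, x k ≤ y → k ≤ m := by
    obtain ⟨N, hN⟩ := exists_nat_gt ((y - x 0) / l)
    refine ⟨N, fun k hk => ?_⟩
    by_contra! h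
    have h1 := hx.sep_mul_abs_le k 0
    have hk0 : (0 : ℤ) < k := by omega
    rw [abs_of_pos (sub_pos.2 (hx.strictMono hk0)), sub_zero,
      abs_of_pos (by exact_mod_cast hk0)] at h1
    rw [div_lt_iff₀ hpos] at hN
    have : (N : ℝ) < k := by exact_mod_cast h
    nlinarith
  have hsmall : ∃ k : ℤ, x k ≤ y := by
    obtain ⟨N, hN⟩ := exists_nat_gt ((x 0 - y) / l)
    refine ⟨-(N + 1 : ℤ), ?_⟩
    have h1 := hx.sep_mul_abs_le (-(N + 1 : ℤ)) 0
    have hk0 : (-(N + 1 : ℤ)) < 0 := by omega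
    rw [abs_of_neg (sub_neg.2 (hx.strictMono hk0)), sub_zero,
      abs_of_neg (by exact_mod_cast hk0)] at h1
    rw [div_lt_iff₀ hpos] at hN
    push_cast at h1
    nlinarith
  obtain ⟨n, hn, hmax⟩ := Int.exists_greatest_of_bdd (P := fun k => x k ≤ y) hlarge hsmall
  refine ⟨n, fun k => ?_⟩
  rcases le_or_gt k n with h | h
  · have h1 := hx.sep_mul_abs_le k n
    have h2 : x k ≤ x n := hx.strictMono.monotone h
    rw [abs_of_nonpos (sub_nonpos.2 h2)] at h1
    have h3 : |y - x k| ≥ x n - x k := by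
      rw [abs_of_nonneg (by linarith)]; linarith
    set d := |((k - n : ℤ) : ℝ)| with hd
    have hd0 : 0 ≤ d := abs_nonneg _
    nlinarith
  · have h1 := hx.sep_mul_abs_le k (n + 1)
    have h2 : x (n + 1) ≤ x k := hx.strictMono.monotone (by omega)
    have h4 : y < x (n + 1) := by
      by_contra! h'
      have := hmax _ h'
      omega
    rw [abs_of_nonneg (sub_nonneg.2 h2)] at h1
    have h3 : |y - x k| ≥ x k - x (n + 1) := by
      rw [abs_of_nonpos (by linarith)]; linarith
    have hkn : (1 : ℝ) ≤ ((k - n : ℤ) : ℝ) := by exact_mod_cast (by omega : (1 : ℤ) ≤ k - n)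
    have e : ((k - (n + 1) : ℤ) : ℝ) = ((k - n : ℤ) : ℝ) - 1 := by push_cast; ring
    rw [e, abs_of_nonneg (by linarith)] at h1
    rw [abs_of_nonneg (by linarith)]
    set d := ((k - n : ℤ) : ℝ) with hd
    nlinarith

lemma IsSeparatedSeq.exists_sum_min_le {x : ℤ → ℝ} (hx : IsSeparatedSeq x) :
    ∃ C : ℝ, 0 < C ∧ ∀ (y t : ℝ), 0 ≤ t → ∀ s : Finset ℤ,
      ∑ k ∈ s, min ((1 + |y - x k|)⁻¹) (t * ((1 + |y - x k|)⁻¹) ^ 2) ≤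
        C * (1 + Real.log (1 + t)) := by
  obtain ⟨c, hc, hc1, h⟩ := hx.exists_le_of_real
  refine ⟨(c⁻¹) ^ 2 * 6, by positivity, fun y t ht s => ?_⟩
  obtain ⟨n, hn⟩ := h y
  have hlog : 0 ≤ Real.log (1 + t) := Real.log_nonneg (by linarith)
  have hD : 1 ≤ c⁻¹ := (one_le_inv₀ hc).2 hc1
  calc _ ≤ ∑ k ∈ s, (c⁻¹) ^ 2 * min ((1 + |((k - n : ℤ) : ℝ)|)⁻¹)
          ((1 + t) * ((1 + |((k - n : ℤ) : ℝ)|)⁻¹) ^ 2) := by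
        refine Finset.sum_le_sum fun k _ => ?_
        set a := (1 + |((k - n : ℤ) : ℝ)|)⁻¹ with ha
        have ha0 : 0 ≤ a := by positivity
        have hle : (1 + |y - x k|)⁻¹ ≤ c⁻¹ * a := by
          rw [ha, ← mul_inv]
          exact inv_anti₀ (by positivity) (hn k)
        have h0 : 0 ≤ (1 + |y - x k|)⁻¹ := by positivity
        rw [mul_min_of_nonneg _ _ (by positivity)]
        refine min_le_min ?_ ?_
        · refine hle.trans ?_
          have : c⁻¹ ≤ (c⁻¹) ^ 2 := by nlinarith
          gcongr
        · calc t * ((1 + |y - x k|)⁻¹) ^ 2 ≤ (1 + t) * (c⁻¹ * a) ^ 2 := by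
                gcongr; linarith
            _ = _ := by ring
    _ = (c⁻¹) ^ 2 * ∑ j ∈ s.image (fun k => k - n), min ((1 + |(j : ℝ)|)⁻¹)
          ((1 + t) * ((1 + |(j : ℝ)|)⁻¹) ^ 2) := by
        rw [← Finset.mul_sum, Finset.sum_image (fun i _ j _ h => by simpa using h)]
    _ ≤ (c⁻¹) ^ 2 * (2 * (3 + Real.log (1 + t))) := by
        gcongr
        exact sum_int_min_inv_le (by linarith) _
    _ ≤ _ := by
        rw [mul_assoc]
        refine mul_le_mul_of_nonneg_left ?_ (by positivity)
        linarith

/-- With `m = max a b`, `a + b ≤ 2m` and `ab ≤ m²`. This decouples the kernel bound into a sum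
centred at `z` and one centred at `x̃`. -/
lemma min_add_mul_le {a b t : ℝ} (ha : 0 ≤ a) (hb : 0 ≤ b) (ht : 0 ≤ t) :
    min (a + b) (t * (a * b)) ≤ 2 * min a (t * a ^ 2) + 2 * min b (t * b ^ 2) := by
  have h : ∀ {a b : ℝ}, 0 ≤ a → 0 ≤ b → a ≤ b → min (a + b) (t * (a * b)) ≤
      2 * min b (t * b ^ 2) := by
    intro a b ha hb hab
    rw [mul_min_of_nonneg _ _ zero_le_two]
    refine min_le_min (by linarith) ?_
    have : t * (a * b) ≤ t * b ^ 2 := by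
      rw [sq]; gcongr
    have : 0 ≤ t * b ^ 2 := by positivity
    linarith
  have ha' : 0 ≤ min a (t * a ^ 2) := le_min ha (by positivity)
  have hb' : 0 ≤ min b (t * b ^ 2) := le_min hb (by positivity)
  rcases le_total a b with hab | hab
  · linarith [h ha hb hab]
  · have := h hb ha hab
    rw [add_comm, mul_comm b a] at this
    linarith

lemma IsSeparatedSeq.summable_inv_sq {x : ℤ → ℝ} (hx : IsSeparatedSeq x) (z : ℂ) :
    Summable fun k : ℤ => ((1 + ‖z - x k‖)⁻¹) ^ 2 := by
  obtain ⟨C, -, h⟩ := hx.exists_sum_min_le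
  refine summable_of_sum_le (c := C * (1 + Real.log (1 + 1))) (fun k => by positivity) fun s => ?_
  refine le_trans (Finset.sum_le_sum fun k _ => ?_) (h z.re 1 zero_le_one s)
  have hle : (1 + ‖z - x k‖)⁻¹ ≤ (1 + |z.re - x k|)⁻¹ := by
    have := Complex.abs_re_le_norm (z - x k)
    rw [Complex.sub_re, Complex.ofReal_re] at this
    gcongr
  have h1 : (1 + |z.re - x k|)⁻¹ ≤ 1 :=
    inv_le_one_of_one_le₀ (by linarith [abs_nonneg (z.re - x k)])
  have h2 : 0 ≤ (1 + ‖z - x k‖)⁻¹ := by positivity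
  refine le_min ?_ ?_
  · nlinarith
  · rw [one_mul]; gcongr

/-! ### Growth of the generating function and of the kernels -/

lemma norm_le_of_forall_sphere {g : ℂ → ℂ} (hg : Differentiable ℂ g) {c : ℂ} {R B : ℝ}
    (h : ∀ w, ‖w - c‖ = R → ‖g w‖ ≤ B) {z : ℂ} (hz : ‖z - c‖ < R) : ‖g z‖ ≤ B := by
  refine Complex.norm_le_of_forall_mem_frontier_norm_le (U := Metric.ball c R)
    Metric.isBounded_ball hg.diffContOnCl (fun w hw => ?_)
    (subset_closure (by simpa [Complex.dist_eq] using hz))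
  have := Metric.frontier_ball_subset_sphere hw
  exact h w (by simpa [Complex.dist_eq] using this)

lemma exp_mul_abs_im_le (b : ℝ) (w z : ℂ) :
    Real.exp (Real.pi * b * |w.im|) ≤
      Real.exp (Real.pi * |b| * ‖w - z‖) * Real.exp (Real.pi * b * |z.im|) := by
  rw [← Real.exp_add, Real.exp_le_exp]
  have h1 : ‖|w.im| - |z.im|‖ ≤ ‖w - z‖ := by
    have h2 := Complex.abs_im_le_norm (w - z)
    rw [Complex.sub_im] at h2
    rw [Real.norm_eq_abs]
    exact (abs_abs_sub_abs_le _ _).trans h2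
  have h3 : b * (|w.im| - |z.im|) ≤ |b| * ‖w - z‖ := by
    refine (le_abs_self _).trans ?_
    rw [abs_mul]
    gcongr
    exact h1
  nlinarith [Real.pi_pos]

/-- Near `x_k` the bound comes from the maximum principle on the circle of radius `l/2` about `x_k`,
which stays at distance `l/2` from all of `X`; the exponential weight varies there by a bounded
factor. -/
lemma IsSineTypeGenerating.exists_norm_le {x : ℤ → ℝ} (hx : IsSeparatedSeq x) {S : ℂ → ℂ} {b : ℝ}
    (hS : IsSineTypeGenerating x S b) :
    ∃ C : ℝ, 0 < C ∧ ∀ z, ‖S z‖ ≤ C * Real.exp (Real.pi * b * |z.im|) := by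
  have hpos := hx.separationConstant_pos
  set l := separationConstant x with hl
  obtain ⟨C₁, C₂, -, hC, hb⟩ := hS.bounds (l / 4) (by positivity)
  have hb' : ∀ z, l / 4 < Metric.infDist z (pointSet x) →
      ‖S z‖ ≤ C₂ * Real.exp (Real.pi * b * |z.im|) := by
    intro z hz
    have := (hb z hz).2
    rwa [Real.exp_neg, inv_mul_eq_div, div_le_iff₀ (Real.exp_pos _)] at this
  set Q := Real.exp (Real.pi * |b| * l) with hQ
  have hQ1 : 1 ≤ Q := Real.one_le_exp (by positivity)
  refine ⟨C₂ * Q, by positivity, fun z => ?_⟩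
  rcases lt_or_ge (l / 4) (Metric.infDist z (pointSet x)) with h | h
  · refine (hb' z h).trans ?_
    gcongr
    nlinarith
  · obtain ⟨_, ⟨k, rfl⟩, hk⟩ := (Metric.infDist_lt_iff (pointSet_nonempty x)).1
      (lt_of_le_of_lt h (by linarith : l / 4 < l / 2))
    rw [Complex.dist_eq] at hk
    refine norm_le_of_forall_sphere hS.differentiable (c := x k) (R := l / 2) (fun w hw => ?_) hk
    have hd : l / 4 < Metric.infDist w (pointSet x) := by
      refine lt_of_lt_of_le (by linarith : l / 4 < l / 2)
        ((Metric.le_infDist (pointSet_nonempty x)).2 ?_)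
      rintro _ ⟨j, rfl⟩
      simp only [Complex.dist_eq]
      by_cases hjk : j = k
      · rw [hjk, hw]
      · have h1 := hx.sep_le hjk
        have h2 : ‖(x j : ℂ) - x k‖ = |x j - x k| := by
          rw [← Complex.ofReal_sub, Complex.norm_real, Real.norm_eq_abs]
        have h3 : ‖(x j : ℂ) - x k‖ ≤ ‖(x j : ℂ) - w‖ + ‖w - x k‖ :=
          norm_sub_le_norm_sub_add_norm_sub _ _ _
        rw [norm_sub_rev (x j : ℂ) w] at h3
        linarith
    have hwz : ‖w - z‖ ≤ l := by
      have h3 : ‖w - z‖ ≤ ‖w - x k‖ + ‖(x k : ℂ) - z‖ := norm_sub_le_norm_sub_add_norm_sub _ _ _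
      rw [norm_sub_rev (x k : ℂ) z] at h3
      linarith
    calc ‖S w‖ ≤ C₂ * Real.exp (Real.pi * b * |w.im|) := hb' w hd
      _ ≤ C₂ * (Real.exp (Real.pi * |b| * ‖w - z‖) * Real.exp (Real.pi * b * |z.im|)) := by
          gcongr
          exact exp_mul_abs_im_le b w z
      _ ≤ C₂ * (Q * Real.exp (Real.pi * b * |z.im|)) := by
          rw [hQ]; gcongr
      _ = _ := by ring

lemma IsSineTypeGenerating.exists_norm_dslope_le {x : ℤ → ℝ} (hx : IsSeparatedSeq x)
    {S : ℂ → ℂ} {b : ℝ} (hS : IsSineTypeGenerating x S b) :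
    ∃ C : ℝ, 0 < C ∧ ∀ (k : ℤ) (z : ℂ), ‖dslope S (x k) z‖ ≤
      C * Real.exp (Real.pi * b * |z.im|) * (1 + ‖z - x k‖)⁻¹ := by
  obtain ⟨C, hC, h⟩ := hS.exists_norm_le hx
  set Q := Real.exp (Real.pi * |b| * 2) with hQ
  have hQ1 : 1 ≤ Q := Real.one_le_exp (by positivity)
  refine ⟨2 * (C * Q), by positivity, fun k z => ?_⟩
  set M := Real.exp (Real.pi * b * |z.im|) with hM
  have hM0 : 0 < M := Real.exp_pos _
  have hS0 := hS.generating.apply_eq_zero hx k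
  rw [← div_eq_mul_inv, le_div_iff₀ (by positivity)]
  rcases lt_or_ge ‖z - x k‖ 1 with hz | hz
  · have h1 : ‖dslope S (x k) z‖ ≤ C * Q * M := by
      refine norm_le_of_forall_sphere (differentiable_dslope hS.differentiable _) (c := x k)
        (R := 1) (fun w hw => ?_) hz
      have hne : w ≠ x k := by
        rintro rfl
        simp at hw
      have hwz : ‖w - z‖ ≤ 2 := by
        have h3 : ‖w - z‖ ≤ ‖w - x k‖ + ‖(x k : ℂ) - z‖ :=
          norm_sub_le_norm_sub_add_norm_sub _ _ _
        rw [norm_sub_rev (x k : ℂ) z] at h3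
        linarith
      rw [dslope_eq_div hS0 hne, norm_div, hw, div_one]
      calc ‖S w‖ ≤ C * Real.exp (Real.pi * b * |w.im|) := h w
        _ ≤ C * (Real.exp (Real.pi * |b| * ‖w - z‖) * M) := by
            gcongr
            exact exp_mul_abs_im_le b w z
        _ ≤ C * (Q * M) := by rw [hQ]; gcongr
        _ = _ := by ring
    calc _ ≤ (C * Q * M) * (1 + 1) := by gcongr
      _ = _ := by ring
  · have h1 : ‖z - x k‖ * ‖dslope S (x k) z‖ ≤ C * M := by
      rw [← norm_mul, sub_mul_dslope hS0]; exact h z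
    have h2 : ‖dslope S (x k) z‖ ≤ ‖z - x k‖ * ‖dslope S (x k) z‖ :=
      le_mul_of_one_le_left (norm_nonneg _) hz
    have h3 : C * M ≤ C * Q * M := by
      have : C * M * 1 ≤ C * M * Q := by gcongr
      linarith
    linarith

lemma exists_norm_interpKernel_le {x : ℤ → ℝ} (hx : IsSeparatedSeq x) {S : ℂ → ℂ} {b : ℝ}
    (hS : IsSineTypeGenerating x S b) {xt : ℂ} (hxt : xt ∉ pointSet x) :
    ∃ C : ℝ, 0 < C ∧ ∀ (k : ℤ) (z : ℂ), ‖interpKernel x S xt k z‖ ≤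
      C * Real.exp (Real.pi * b * |z.im|) *
        (‖z - xt‖ * ((1 + ‖z - x k‖)⁻¹ * (1 + ‖xt - x k‖)⁻¹)) := by
  obtain ⟨C, hC, h⟩ := hS.exists_norm_dslope_le hx
  obtain ⟨c, hc, h'⟩ := hS.exists_le_norm_deriv hx
  set δ := Metric.infDist xt (pointSet x) with hδ
  have hδ0 : 0 < δ := (hx.isClosed_pointSet.notMem_iff_infDist_pos (pointSet_nonempty x)).1 hxt
  refine ⟨C * ((1 + δ) / δ) / c, by positivity, fun k z => ?_⟩
  have hdk : δ ≤ ‖xt - x k‖ := by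
    have := Metric.infDist_le_dist_of_mem (x := xt) (ofReal_mem_pointSet x k)
    rwa [Complex.dist_eq] at this
  have hinv : ‖xt - x k‖⁻¹ ≤ (1 + δ) / δ * (1 + ‖xt - x k‖)⁻¹ := by
    have hp : 0 < ‖xt - x k‖ := hδ0.trans_le hdk
    rw [← div_eq_mul_inv, le_div_iff₀ (by positivity), inv_mul_le_iff₀ hp, mul_div_assoc',
      le_div_iff₀ hδ0]
    nlinarith
  rw [interpKernel_eq hx hS hxt, norm_div, norm_div, norm_mul, norm_sub_rev xt z]
  calc _ = ‖dslope S (x k) z‖ * ‖z - xt‖ * ‖xt - x k‖⁻¹ * ‖deriv S (x k)‖⁻¹ := by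
        simp only [div_eq_mul_inv]
    _ ≤ (C * Real.exp (Real.pi * b * |z.im|) * (1 + ‖z - x k‖)⁻¹) * ‖z - xt‖ *
        ((1 + δ) / δ * (1 + ‖xt - x k‖)⁻¹) * c⁻¹ := by
        gcongr
        · exact h k z
        · exact h' k
    _ = _ := by rw [div_eq_mul_inv _ c]; ring

lemma exists_sum_norm_interpKernel_le {x : ℤ → ℝ} (hx : IsSeparatedSeq x) {S : ℂ → ℂ} {b : ℝ}
    (hS : IsSineTypeGenerating x S b) {xt : ℂ} (hxt : xt ∉ pointSet x) :
    ∃ C : ℝ, 0 < C ∧ ∀ (z : ℂ) (s : Finset ℤ), ∑ k ∈ s, ‖interpKernel x S xt k z‖ ≤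
      C * Real.exp (Real.pi * b * |z.im|) * (1 + Real.log (1 + ‖z - xt‖)) := by
  obtain ⟨C, hC, h⟩ := exists_norm_interpKernel_le hx hS hxt
  obtain ⟨D, hD, hsum⟩ := hx.exists_sum_min_le
  refine ⟨C * (4 * D), by positivity, fun z s => ?_⟩
  set M := Real.exp (Real.pi * b * |z.im|) with hM
  set t := ‖z - xt‖ with ht
  have hA : ∀ (w : ℂ) (k : ℤ), (1 + ‖w - x k‖)⁻¹ ≤ (1 + |w.re - x k|)⁻¹ := by
    intro w k
    have := Complex.abs_re_le_norm (w - x k)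
    rw [Complex.sub_re, Complex.ofReal_re] at this
    gcongr
  calc ∑ k ∈ s, ‖interpKernel x S xt k z‖
      ≤ ∑ k ∈ s, C * M * (2 * min ((1 + |z.re - x k|)⁻¹) (t * ((1 + |z.re - x k|)⁻¹) ^ 2) +
          2 * min ((1 + |xt.re - x k|)⁻¹) (t * ((1 + |xt.re - x k|)⁻¹) ^ 2)) := by
        refine Finset.sum_le_sum fun k _ => (h k z).trans ?_
        gcongr
        -- With `a = (1 + |z - x_k|)⁻¹` and `b = (1 + |x̃ - x_k|)⁻¹`, the triangle inequality gives
        -- `t ≤ 1/a + 1/b`, hence `t a b ≤ a + b`.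
        refine le_trans ?_ (min_add_mul_le (by positivity) (by positivity) (norm_nonneg _))
        have hu := hA z k
        have hv := hA xt k
        refine le_min ?_ (by gcongr)
        refine le_trans ?_ (add_le_add hu hv)
        have htri : t ≤ (1 + ‖z - x k‖) + (1 + ‖xt - x k‖) := by
          have h3 : ‖z - xt‖ ≤ ‖z - x k‖ + ‖(x k : ℂ) - xt‖ :=
            norm_sub_le_norm_sub_add_norm_sub _ _ _
          rw [norm_sub_rev (x k : ℂ) xt] at h3
          linarith
        calc _ ≤ ((1 + ‖z - x k‖) + (1 + ‖xt - x k‖)) *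
              ((1 + ‖z - x k‖)⁻¹ * (1 + ‖xt - x k‖)⁻¹) := by gcongr
          _ = _ := by
              have h1 : (1 + ‖z - x k‖) ≠ 0 := by positivity
              have h2 : (1 + ‖xt - x k‖) ≠ 0 := by positivity
              field_simp
              ring
    _ = C * M * (2 * (∑ k ∈ s, min ((1 + |z.re - x k|)⁻¹) (t * ((1 + |z.re - x k|)⁻¹) ^ 2)) +
          2 * ∑ k ∈ s, min ((1 + |xt.re - x k|)⁻¹) (t * ((1 + |xt.re - x k|)⁻¹) ^ 2)) := by
        rw [← Finset.mul_sum, Finset.sum_add_distrib, ← Finset.mul_sum, ← Finset.mul_sum]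
    _ ≤ C * M * (2 * (D * (1 + Real.log (1 + t))) + 2 * (D * (1 + Real.log (1 + t)))) := by
        gcongr
        · exact hsum z.re t (norm_nonneg _) s
        · exact hsum xt.re t (norm_nonneg _) s
    _ = _ := by ring

/-- For `|z| ≤ R`, `1 + |x̃ - x_k|` is at most a constant times `1 + |z - x_k|`, so the kernel is
`O((1 + |x̃ - x_k|)⁻²)`; this is the majorant for the Weierstrass test. -/
lemma exists_summable_norm_interpKernel_le {x : ℤ → ℝ} (hx : IsSeparatedSeq x) {S : ℂ → ℂ}
    {b : ℝ} (hS : IsSineTypeGenerating x S b) {xt : ℂ} (hxt : xt ∉ pointSet x) (R : ℝ) :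
    ∃ u : ℤ → ℝ, Summable u ∧ ∀ (k : ℤ) (z : ℂ), ‖z‖ ≤ R → ‖interpKernel x S xt k z‖ ≤ u k := by
  obtain ⟨C, hC, h⟩ := exists_norm_interpKernel_le hx hS hxt
  set T := R + ‖xt‖ with hT
  refine ⟨fun k => C * Real.exp (Real.pi * |b| * R) * (T * (1 + T)) * ((1 + ‖xt - x k‖)⁻¹) ^ 2,
    (hx.summable_inv_sq xt).mul_left _, fun k z hz => (h k z).trans ?_⟩
  have hR : 0 ≤ R := (norm_nonneg _).trans hz
  have ht : ‖z - xt‖ ≤ T := (norm_sub_le _ _).trans (by linarith)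
  have hT0 : 0 ≤ T := (norm_nonneg _).trans ht
  have hexp : Real.exp (Real.pi * b * |z.im|) ≤ Real.exp (Real.pi * |b| * R) := by
    have := exp_mul_abs_im_le b z 0
    simp only [sub_zero, Complex.zero_im, abs_zero, mul_zero, Real.exp_zero, mul_one] at this
    refine this.trans ?_
    gcongr
  have hinv : (1 + ‖z - x k‖)⁻¹ ≤ (1 + T) * (1 + ‖xt - x k‖)⁻¹ := by
    rw [← div_eq_mul_inv, le_div_iff₀ (by positivity), inv_mul_le_iff₀ (by positivity)]
    have h3 : ‖xt - x k‖ ≤ ‖xt - z‖ + ‖z - x k‖ := norm_sub_le_norm_sub_add_norm_sub _ _ _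
    rw [norm_sub_rev xt z] at h3
    nlinarith [norm_nonneg (z - x k)]
  calc _ ≤ C * Real.exp (Real.pi * |b| * R) *
        (T * (((1 + T) * (1 + ‖xt - x k‖)⁻¹) * (1 + ‖xt - x k‖)⁻¹)) := by gcongr
    _ = _ := by ring

/-! ### Interpolation of bounded sequences -/

lemma norm_circleMap_zero_of_pos {r : ℝ} (hr : 0 < r) (θ : ℝ) : ‖circleMap 0 r θ‖ = r := by
  rw [norm_circleMap_zero, abs_of_pos hr]

lemma mem_PWPlus_of_norm_le {b D : ℝ} {f : ℂ → ℂ} (hf : Differentiable ℂ f)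
    (h : ∀ z : ℂ, ‖f z‖ ≤
      D * Real.exp (Real.pi * b * |z.im|) * (1 + max (Real.log ‖z‖) 0)) : f ∈ PWPlus b := by
  refine ⟨hf, ?_⟩
  have hlim : Tendsto (fun r : ℝ => D * (r⁻¹ + Real.log r / r) * |2 * Real.pi - 0|) atTop
      (𝓝 0) := by
    have h1 : Tendsto (fun r : ℝ => Real.log r / r) atTop (𝓝 0) :=
      Real.isLittleO_log_id_atTop.tendsto_div_nhds_zero
    simpa using ((tendsto_inv_atTop_zero.add h1).const_mul D).mul_const |2 * Real.pi - 0|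
  refine squeeze_zero_norm' ?_ hlim
  filter_upwards [eventually_ge_atTop 1] with r hr
  have hr0 : 0 < r := by linarith
  refine intervalIntegral.norm_integral_le_of_norm_le_const fun θ _ => ?_
  set z := circleMap 0 r θ with hz
  have hzr : ‖z‖ = r := norm_circleMap_zero_of_pos hr0 θ
  have h1 := h z
  rw [hzr, max_eq_left (Real.log_nonneg hr)] at h1
  rw [Real.norm_of_nonneg (by positivity), hzr]
  calc (r ^ 2)⁻¹ * Real.exp (-(Real.pi * b * |z.im|)) * ‖f z‖ * r
      ≤ (r ^ 2)⁻¹ * Real.exp (-(Real.pi * b * |z.im|)) *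
        (D * Real.exp (Real.pi * b * |z.im|) * (1 + Real.log r)) * r := by gcongr
    _ = D * (r⁻¹ + Real.log r / r) := by
        rw [Real.exp_neg]
        field_simp

lemma log_one_add_norm_sub_le (w z : ℂ) :
    Real.log (1 + ‖z - w‖) ≤ Real.log (2 * (1 + ‖w‖)) + max (Real.log ‖z‖) 0 := by
  have h1 : max (Real.log ‖z‖) 0 = Real.log (max ‖z‖ 1) := by
    rcases le_total 1 ‖z‖ with h | h
    · rw [max_eq_left h, max_eq_left (Real.log_nonneg h)]
    · rw [max_eq_right h, max_eq_right (Real.log_nonpos (norm_nonneg _) h), Real.log_one]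
  have hp : 0 < max ‖z‖ 1 := lt_max_of_lt_right one_pos
  rw [h1, ← Real.log_mul (by positivity) hp.ne']
  apply Real.log_le_log (by positivity)
  have h2 := norm_sub_le z w
  have h3 : ‖z‖ ≤ max ‖z‖ 1 := le_max_left _ _
  have h4 : 1 ≤ max ‖z‖ 1 := le_max_right _ _
  nlinarith [norm_nonneg w]

theorem interpolation_of_bounded {x : ℤ → ℝ} (hx : IsSeparatedSeq x) {S : ℂ → ℂ} {b : ℝ}
    (hS : IsSineTypeGenerating x S b) {xt : ℂ} (hxt : xt ∉ pointSet x) :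
    ∃ C : ℝ, ∀ (ta : ℂ) (a : lp (fun _ : ℤ => ℂ) ⊤), ∃ f ∈ PWPlus b,
      (∀ K : Set ℂ, IsCompact K →
        TendstoUniformlyOn
          (fun (s : Finset ℤ) (z : ℂ) => interpPartialSum x S xt ta (⇑a) (↑s : Set ℤ) z)
          f atTop K) ∧
      f xt = ta ∧ (∀ k : ℤ, f (x k : ℂ) = a k) ∧
      ∀ z : ℂ, ‖f z‖ ≤
        C * max ‖a‖ ‖ta‖ * Real.exp (Real.pi * b * |z.im|) * (1 + max (Real.log ‖z‖) 0) := by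
  obtain ⟨D, hD, hDS⟩ := hS.exists_norm_le hx
  obtain ⟨B, hB, hBK⟩ := exists_sum_norm_interpKernel_le hx hS hxt
  have hSxt : S xt ≠ 0 := hS.ne_zero hx hxt
  set L := 1 + Real.log (2 * (1 + ‖xt‖)) with hL
  have hL1 : 1 ≤ L := by
    have : 0 ≤ Real.log (2 * (1 + ‖xt‖)) := Real.log_nonneg (by linarith [norm_nonneg xt])
    linarith
  refine ⟨D / ‖S xt‖ + B * L, fun ta a => ?_⟩
  have hak : ∀ k, ‖a k‖ ≤ ‖a‖ := fun k => lp.norm_apply_le_norm ENNReal.top_ne_zero a k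
  set g : ℂ → ℂ := fun z => ∑' k, a k * interpKernel x S xt k z with hg
  have hunif : ∀ R : ℝ, TendstoUniformlyOn
      (fun (s : Finset ℤ) (z : ℂ) => ∑ k ∈ s, a k * interpKernel x S xt k z) g atTop
      (Metric.closedBall 0 R) := by
    intro R
    obtain ⟨u, hu, hle⟩ := exists_summable_norm_interpKernel_le hx hS hxt R
    refine tendstoUniformlyOn_tsum (hu.mul_left ‖a‖) fun k z hz => ?_
    rw [norm_mul]
    gcongr
    · exact hak k
    · exact hle k z (by simpa using hz)
  have hgd : Differentiable ℂ g := by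
    intro z
    have h1 : TendstoLocallyUniformlyOn
        (fun (s : Finset ℤ) (z : ℂ) => ∑ k ∈ s, a k * interpKernel x S xt k z) g atTop
        (Metric.ball 0 (‖z‖ + 1)) :=
      ((hunif (‖z‖ + 1)).mono Metric.ball_subset_closedBall).tendstoLocallyUniformlyOn
    have h2 := h1.differentiableOn (Eventually.of_forall fun s => by
      have := interpKernel_differentiable hx hS hxt
      exact Differentiable.differentiableOn (by fun_prop)) Metric.isOpen_ball
    exact h2.differentiableAt (Metric.isOpen_ball.mem_nhds (by simp))
  have hgn : ∀ z, ‖g z‖ ≤ ‖a‖ * (B * Real.exp (Real.pi * b * |z.im|) *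
      (1 + Real.log (1 + ‖z - xt‖))) := by
    intro z
    have h1 : ∀ s : Finset ℤ, ∑ k ∈ s, ‖a k * interpKernel x S xt k z‖ ≤ ‖a‖ *
        (B * Real.exp (Real.pi * b * |z.im|) * (1 + Real.log (1 + ‖z - xt‖))) := by
      intro s
      calc _ ≤ ∑ k ∈ s, ‖a‖ * ‖interpKernel x S xt k z‖ := by
            refine Finset.sum_le_sum fun k _ => ?_
            rw [norm_mul]
            gcongr
            exact hak k
        _ = ‖a‖ * ∑ k ∈ s, ‖interpKernel x S xt k z‖ := by rw [Finset.mul_sum]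
        _ ≤ _ := by gcongr; exact hBK z s
    have h2 := summable_of_sum_le (fun _ => norm_nonneg _) h1
    exact (norm_tsum_le_tsum_norm h2).trans (h2.tsum_le_of_sum_le h1)
  set f : ℂ → ℂ := fun z => ta * (S z / S xt) + g z with hf
  have hfd : Differentiable ℂ f := by
    have := hS.differentiable
    fun_prop
  have hbound : ∀ z : ℂ, ‖f z‖ ≤ (D / ‖S xt‖ + B * L) * max ‖a‖ ‖ta‖ *
      Real.exp (Real.pi * b * |z.im|) * (1 + max (Real.log ‖z‖) 0) := by
    intro z
    set M := Real.exp (Real.pi * b * |z.im|) with hM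
    have hM0 : 0 < M := Real.exp_pos _
    set P := max ‖a‖ ‖ta‖ with hP
    have hPa : ‖a‖ ≤ P := le_max_left _ _
    have hPt : ‖ta‖ ≤ P := le_max_right _ _
    have hP0 : 0 ≤ P := (norm_nonneg _).trans hPa
    set Λ := max (Real.log ‖z‖) 0 with hΛ
    have hΛ0 : 0 ≤ Λ := le_max_right _ _
    have hlog : 1 + Real.log (1 + ‖z - xt‖) ≤ L * (1 + Λ) := by
      have := log_one_add_norm_sub_le xt z
      nlinarith
    calc ‖f z‖ ≤ ‖ta * (S z / S xt)‖ + ‖g z‖ := norm_add_le _ _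
      _ ≤ P * (D * M / ‖S xt‖ * (1 + Λ)) + P * (B * M * (L * (1 + Λ))) := by
          refine add_le_add ?_ ((hgn z).trans ?_)
          swap
          · have h0 : 0 ≤ Real.log (1 + ‖z - xt‖) :=
              Real.log_nonneg (by linarith [norm_nonneg (z - xt)])
            exact mul_le_mul hPa (mul_le_mul_of_nonneg_left hlog (by positivity))
              (by positivity) hP0
          rw [norm_mul, norm_div]
          have h1 : ‖S z‖ / ‖S xt‖ ≤ D * M / ‖S xt‖ := by
            gcongr
            exact hDS z
          have h2 : D * M / ‖S xt‖ ≤ D * M / ‖S xt‖ * (1 + Λ) :=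
            le_mul_of_one_le_right (by positivity) (by linarith)
          gcongr
          exact h1.trans h2
      _ = _ := by ring
  refine ⟨f, mem_PWPlus_of_norm_le hfd hbound, ?_, ?_, ?_, hbound⟩
  · intro K hK
    obtain ⟨R, hR⟩ := hK.isBounded.subset_closedBall 0
    have h1 := (hunif R).mono hR
    rw [Metric.tendstoUniformlyOn_iff] at h1 ⊢
    intro ε hε
    filter_upwards [h1 ε hε] with s hs z hz
    have := hs z hz
    simp only [hf, interpPartialSum, finsum_mem_coe_finset, dist_add_left]
    exact this
  · simp [hf, hg, interpKernel_base hx hS hxt, hSxt]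
  · intro k
    simp only [hf, hg]
    rw [hS.generating.apply_eq_zero hx, zero_div, mul_zero, zero_add, tsum_eq_single k]
    · rw [interpKernel_self hx hS hxt, mul_one]
    · intro j hj
      rw [interpKernel_of_ne hx hS hxt hj.symm, mul_zero]

/-! ### The residue formula -/

/-- The residues at `p` and `z` cancel; if `p = z`, the integrand has a primitive. Hence the polar
parts of `f/S` do not contribute to the Cauchy integral. -/
lemma integral_inv_mul_inv_eq_zero {ρ : ℝ} {p z : ℂ} (hp : p ∈ Metric.ball (0 : ℂ) ρ)
    (hz : z ∈ Metric.ball (0 : ℂ) ρ) : (∮ ζ in C(0, ρ), (ζ - p)⁻¹ * (ζ - z)⁻¹) = 0 := by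
  have hρ : 0 < ρ := dist_nonneg.trans_lt hp
  have hint : ∀ w ∈ Metric.ball (0 : ℂ) ρ, CircleIntegrable (fun ζ => (ζ - w)⁻¹) 0 ρ := by
    intro w hw
    rw [circleIntegrable_sub_inv_iff, abs_of_pos hρ]
    exact Or.inr (Metric.sphere_disjoint_ball.notMem_of_mem_right hw)
  rcases eq_or_ne p z with rfl | hne
  · have := circleIntegral.integral_sub_zpow_of_ne (n := -2) (by norm_num) 0 p ρ
    refine Eq.trans (circleIntegral.integral_congr hρ.le fun ζ _ => ?_) this
    rw [zpow_neg, ← mul_inv, ← sq]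
    rfl
  · have h1 : (∮ ζ in C(0, ρ), (ζ - p)⁻¹ * (ζ - z)⁻¹) =
        ∮ ζ in C(0, ρ), (p - z)⁻¹ * ((ζ - p)⁻¹ - (ζ - z)⁻¹) := by
      refine circleIntegral.integral_congr hρ.le fun ζ hζ => ?_
      have hζp : ζ - p ≠ 0 := sub_ne_zero.2 fun e =>
        Metric.sphere_disjoint_ball.notMem_of_mem_left hζ (e ▸ hp)
      have hζz : ζ - z ≠ 0 := sub_ne_zero.2 fun e =>
        Metric.sphere_disjoint_ball.notMem_of_mem_left hζ (e ▸ hz)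
      have hpz : p - z ≠ 0 := sub_ne_zero.2 hne
      change (ζ - p)⁻¹ * (ζ - z)⁻¹ = (p - z)⁻¹ * ((ζ - p)⁻¹ - (ζ - z)⁻¹)
      field_simp
      ring
    rw [h1, circleIntegral.integral_const_mul, circleIntegral.integral_sub (hint p hp) (hint z hz),
      circleIntegral.integral_sub_inv_of_mem_ball hp,
      circleIntegral.integral_sub_inv_of_mem_ball hz, sub_self, mul_zero]

open Classical in
/-- An entire function that vanishes at the points of the sequence in a disc is divisible by the
generating function there. -/
lemma IsSineTypeGenerating.exists_quotient {x : ℤ → ℝ} (hx : IsSeparatedSeq x) {S : ℂ → ℂ} {b : ℝ}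
    (hS : IsSineTypeGenerating x S b) {F : ℂ → ℂ} (hF : Differentiable ℂ F) {U : Set ℂ}
    (h0 : ∀ k, (x k : ℂ) ∈ U → F (x k) = 0) :
    ∃ h : ℂ → ℂ, (∀ z ∈ U, DifferentiableAt ℂ h z) ∧ ∀ z ∈ U, F z = S z * h z := by
  -- Zeros of `S` are simple, so near `x_k` this function is the quotient of two `dslope`s with
  -- nonvanishing denominator.
  refine ⟨fun z => if z ∈ pointSet x then deriv F z / deriv S z else F z / S z, ?_, ?_⟩
  · intro z hz
    by_cases hzX : z ∈ pointSet x
    · obtain ⟨k, rfl⟩ := hzX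
      have hFk := h0 k hz
      have hSk := hS.generating.apply_eq_zero hx k
      have hd : DifferentiableAt ℂ (fun w => dslope F (x k) w / dslope S (x k) w) (x k) :=
        (differentiable_dslope hF _ _).div (differentiable_dslope hS.differentiable _ _) (by
          rw [dslope_same]; exact hS.deriv_ne_zero hx k)
      refine hd.congr_of_eventuallyEq ?_
      filter_upwards [Metric.ball_mem_nhds (x k : ℂ) hx.separationConstant_pos] with w hw
      by_cases hwk : w = x k
      · rw [if_pos (hwk ▸ ofReal_mem_pointSet x k), hwk, dslope_same, dslope_same]
      · have hwX : w ∉ pointSet x := by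
          rintro ⟨j, rfl⟩
          have hjk : j ≠ k := fun e => hwk (by rw [e])
          have h1 := hx.sep_le hjk
          rw [Metric.mem_ball, Complex.dist_eq] at hw
          simp only [← Complex.ofReal_sub, Complex.norm_real, Real.norm_eq_abs] at hw
          linarith
        rw [if_neg hwX, dslope_eq_div hFk hwk, dslope_eq_div hSk hwk,
          div_div_div_cancel_right₀ (sub_ne_zero.2 hwk)]
    · refine ((hF z).div (hS.differentiable z) (hS.ne_zero hx hzX)).congr_of_eventuallyEq ?_
      filter_upwards [hx.isClosed_pointSet.isOpen_compl.mem_nhds hzX] with w hw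
      exact if_neg hw
  · intro z hz
    by_cases hzX : z ∈ pointSet x
    · obtain ⟨k, rfl⟩ := hzX
      simp only [hS.generating.apply_eq_zero hx k, zero_mul]
      exact h0 k hz
    · simp only [if_neg hzX]
      rw [mul_div_cancel₀ _ (hS.ne_zero hx hzX)]

lemma interpPartialSum_eq_sum {x : ℤ → ℝ} (hx : IsSeparatedSeq x) (S : ℂ → ℂ) (xt ta : ℂ)
    (a : ℤ → ℂ) (r : ℝ) (z : ℂ) :
    interpPartialSum x S xt ta a {k : ℤ | |x k| < r} z = ta * (S z / S xt) +
      ∑ k ∈ (hx.finite_abs_lt r).toFinset, a k * interpKernel x S xt k z := by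
  rw [interpPartialSum, finsum_mem_eq_finite_toFinset_sum _ (hx.finite_abs_lt r)]

/-- The remainder vanishes on `X` inside the disc, so it is `S h` with `h` holomorphic. On the
circle `f/S` is `h` plus a constant plus simple fractions with poles inside, so the integral yields
`h(z) - h(x̃)`, and `h(x̃) = 0` because the remainder also vanishes at `x̃`. -/
theorem sub_interpPartialSum_eq_integral {x : ℤ → ℝ} (hx : IsSeparatedSeq x) {S : ℂ → ℂ} {b : ℝ}
    (hS : IsSineTypeGenerating x S b) {xt : ℂ} (hxt : xt ∉ pointSet x) {f : ℂ → ℂ}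
    (hf : Differentiable ℂ f) {ρ : ℝ} (hρ : ∀ k, |x k| ≠ ρ) {z : ℂ} (hz : ‖z‖ < ρ)
    (hxtρ : ‖xt‖ < ρ) :
    f z - interpPartialSum x S xt (f xt) (fun k => f (x k)) {k : ℤ | |x k| < ρ} z =
      S z * ((2 * Real.pi * Complex.I : ℂ)⁻¹ *
        ∮ ζ in C(0, ρ), f ζ / S ζ * ((ζ - z)⁻¹ - (ζ - xt)⁻¹)) := by
  have hρ0 : 0 < ρ := (norm_nonneg _).trans_lt hz
  have hSxt : S xt ≠ 0 := hS.ne_zero hx hxt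
  have hzb : z ∈ Metric.ball (0 : ℂ) ρ := by simpa using hz
  have hxtb : xt ∈ Metric.ball (0 : ℂ) ρ := by simpa using hxtρ
  set N := (hx.finite_abs_lt ρ).toFinset with hN
  have hNb : ∀ k ∈ N, (x k : ℂ) ∈ Metric.ball (0 : ℂ) ρ := by
    intro k hk
    simpa [hN] using hk
  set F : ℂ → ℂ := fun z =>
    f z - interpPartialSum x S xt (f xt) (fun k => f (x k)) {k : ℤ | |x k| < ρ} z with hFdef
  have hFeq : ∀ z, F z = f z - (f xt * (S z / S xt) +
      ∑ k ∈ N, f (x k) * interpKernel x S xt k z) := fun z => by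
    rw [hFdef, hN, ← interpPartialSum_eq_sum hx S xt (f xt) (fun k => f (x k)) ρ z]
  have hFd : Differentiable ℂ F := by
    rw [funext hFeq]
    have h1 := interpKernel_differentiable hx hS hxt
    have h2 := hS.differentiable
    fun_prop
  have hF0 : ∀ k, (x k : ℂ) ∈ Metric.closedBall (0 : ℂ) ρ → F (x k) = 0 := by
    intro k hk
    have hk' : |x k| ≤ ρ := by simpa using hk
    have hkN : k ∈ N := by simpa [hN] using lt_of_le_of_ne hk' (hρ k)
    rw [hFeq, hS.generating.apply_eq_zero hx k, Finset.sum_eq_single k,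
      interpKernel_self hx hS hxt]
    · simp
    · intro j _ hj
      rw [interpKernel_of_ne hx hS hxt hj.symm, mul_zero]
    · exact fun h => absurd hkN h
  obtain ⟨h, hhd, hhF⟩ := hS.exists_quotient hx hFd hF0
  have hFxt : F xt = 0 := by
    rw [hFeq]
    simp [interpKernel_base hx hS hxt, hSxt]
  have hhxt : h xt = 0 := by
    have := hhF xt (Metric.ball_subset_closedBall hxtb)
    rw [hFxt] at this
    exact (mul_eq_zero.1 this.symm).resolve_left hSxt
  set c : ℤ → ℂ := fun k => f (x k) / deriv S (x k) with hc
  set c₀ : ℂ := f xt / S xt - ∑ k ∈ N, c k * (xt - x k)⁻¹ with hc₀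
  have hsph : ∀ ζ ∈ Metric.sphere (0 : ℂ) ρ, ζ ∉ pointSet x := by
    rintro _ hζ ⟨k, rfl⟩
    exact hρ k (by simpa using hζ)
  have hrep : ∀ ζ ∈ Metric.sphere (0 : ℂ) ρ,
      f ζ / S ζ = (h ζ + c₀) + ∑ k ∈ N, c k * (ζ - x k)⁻¹ := by
    intro ζ hζ
    have hζS : S ζ ≠ 0 := hS.ne_zero hx (hsph ζ hζ)
    have h1 := hhF ζ (Metric.sphere_subset_closedBall hζ)
    have h2 : h ζ = F ζ / S ζ := by rw [h1, mul_div_cancel_left₀ _ hζS]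
    have h3 : (∑ k ∈ N, f (x k) * interpKernel x S xt k ζ) / S ζ =
        ∑ k ∈ N, c k * (ζ - x k)⁻¹ - ∑ k ∈ N, c k * (xt - x k)⁻¹ := by
      rw [← Finset.sum_sub_distrib, Finset.sum_div]
      refine Finset.sum_congr rfl fun k _ => ?_
      have e1 := sub_ofReal_ne_zero (hsph ζ hζ) k
      have e2 := sub_ofReal_ne_zero hxt k
      have e3 := hS.deriv_ne_zero hx k
      rw [interpKernel_eq hx hS hxt,
        dslope_eq_div (hS.generating.apply_eq_zero hx k) (sub_ne_zero.1 e1), hc]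
      field_simp
      ring
    rw [h2, hFeq, sub_div, add_div, h3, hc₀]
    field_simp
    ring
  have hcinv : ∀ w ∈ Metric.ball (0 : ℂ) ρ,
      ContinuousOn (fun ζ => (ζ - w)⁻¹) (Metric.sphere (0 : ℂ) ρ) := by
    intro w hw
    refine ContinuousOn.inv₀ (by fun_prop) fun ζ hζ => sub_ne_zero.2 fun e => ?_
    exact Metric.sphere_disjoint_ball.notMem_of_mem_left hζ (e ▸ hw)
  have hhd' : DifferentiableOn ℂ (fun ζ => h ζ + c₀) (Metric.closedBall 0 ρ) := fun w hw =>
    ((hhd w hw).add_const c₀).differentiableWithinAt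
  have hhc : ContinuousOn (fun ζ => h ζ + c₀) (Metric.sphere (0 : ℂ) ρ) :=
    hhd'.continuousOn.mono Metric.sphere_subset_closedBall
  have hA : ∀ w ∈ Metric.ball (0 : ℂ) ρ,
      (∮ ζ in C(0, ρ), f ζ / S ζ * (ζ - w)⁻¹) = 2 * Real.pi * Complex.I * (h w + c₀) := by
    intro w hw
    have e : (∮ ζ in C(0, ρ), f ζ / S ζ * (ζ - w)⁻¹) = ∮ ζ in C(0, ρ), ((ζ - w)⁻¹ • (h ζ + c₀) +
        ∑ k ∈ N, c k * ((ζ - x k)⁻¹ * (ζ - w)⁻¹)) := by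
      refine circleIntegral.integral_congr hρ0.le fun ζ hζ => ?_
      rw [hrep ζ hζ, add_mul, Finset.sum_mul, smul_eq_mul, mul_comm]
      congr 1
      exact Finset.sum_congr rfl fun k _ => by ring
    have hint : ∀ k ∈ N, CircleIntegrable (fun ζ => c k * ((ζ - x k)⁻¹ * (ζ - w)⁻¹)) 0 ρ :=
      fun k hk => (continuousOn_const.mul
        ((hcinv _ (hNb k hk)).mul (hcinv w hw))).circleIntegrable hρ0.le
    have hint' : CircleIntegrable (fun ζ => ∑ k ∈ N, c k * ((ζ - x k)⁻¹ * (ζ - w)⁻¹)) 0 ρ :=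
      (continuousOn_finsetSum N fun k hk => continuousOn_const.mul
        ((hcinv _ (hNb k hk)).mul (hcinv w hw))).circleIntegrable hρ0.le
    have hint₀ : CircleIntegrable (fun ζ => (ζ - w)⁻¹ • (h ζ + c₀)) 0 ρ :=
      ((hcinv w hw).smul hhc).circleIntegrable hρ0.le
    rw [e, circleIntegral.integral_add hint₀ hint',
      hhd'.circleIntegral_sub_inv_smul hw, circleIntegral.integral_fun_sum hint,
      Finset.sum_eq_zero, add_zero, smul_eq_mul]
    intro k hk
    rw [circleIntegral.integral_const_mul, integral_inv_mul_inv_eq_zero (hNb k hk) hw, mul_zero]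
  have hfS : ContinuousOn (fun ζ => f ζ / S ζ) (Metric.sphere (0 : ℂ) ρ) :=
    hf.continuous.continuousOn.div hS.differentiable.continuous.continuousOn fun ζ hζ =>
      hS.ne_zero hx (hsph ζ hζ)
  have hB : (∮ ζ in C(0, ρ), f ζ / S ζ * ((ζ - z)⁻¹ - (ζ - xt)⁻¹)) =
      2 * Real.pi * Complex.I * h z := by
    have hint : ∀ w ∈ Metric.ball (0 : ℂ) ρ,
        CircleIntegrable (fun ζ => f ζ / S ζ * (ζ - w)⁻¹) 0 ρ := fun w hw =>
      (hfS.mul (hcinv w hw)).circleIntegrable hρ0.le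
    simp only [mul_sub]
    rw [circleIntegral.integral_sub (hint z hzb) (hint xt hxtb), hA z hzb, hA xt hxtb, hhxt]
    ring
  rw [hB, inv_mul_cancel_left₀ Complex.two_pi_I_ne_zero]
  exact hhF z (Metric.ball_subset_closedBall hzb)

lemma circleGrowth_nonneg (b : ℝ) (f : ℂ → ℂ) {r : ℝ} (hr : 0 ≤ r) : 0 ≤ circleGrowth b f r :=
  intervalIntegral.integral_nonneg Real.two_pi_pos.le fun θ _ => by positivity

/-- The difference of Cauchy kernels is at most `4|z - x̃|/ρ²`, matching the weight in
`circleGrowth`. A separate `g` is allowed because the estimate is also needed for `f` times a linear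
factor, with `Q` of order `ρ`. -/
lemma norm_sub_interpPartialSum_le {x : ℤ → ℝ} (hx : IsSeparatedSeq x) {S : ℂ → ℂ} {b : ℝ}
    (hS : IsSineTypeGenerating x S b) {xt : ℂ} (hxt : xt ∉ pointSet x) {f g : ℂ → ℂ}
    (hf : Differentiable ℂ f) (hg : Differentiable ℂ g) {ρ c Q : ℝ} (hρ0 : 0 < ρ)
    (hρ : ∀ k, |x k| ≠ ρ) (hc : 0 < c)
    (hlow : ∀ ζ : ℂ, ‖ζ‖ = ρ → c * Real.exp (Real.pi * b * |ζ.im|) ≤ ‖S ζ‖)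
    (hgf : ∀ ζ : ℂ, ‖ζ‖ = ρ → ‖g ζ‖ ≤ Q * ‖f ζ‖) {z : ℂ} (hz : ‖z‖ ≤ ρ / 2)
    (hxtρ : ‖xt‖ ≤ ρ / 2) :
    ‖g z - interpPartialSum x S xt (g xt) (fun k => g (x k)) {k : ℤ | |x k| < ρ} z‖ ≤
      ‖S z‖ * ‖z - xt‖ / c * (Q * circleGrowth b f ρ) := by
  rw [sub_interpPartialSum_eq_integral hx hS hxt hg hρ (by linarith) (by linarith), norm_mul,
    norm_mul]
  have hpi : ‖(2 * Real.pi * Complex.I : ℂ)⁻¹‖ = (2 * Real.pi)⁻¹ := by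
    simp [Real.pi_pos.le]
  have hsub : ∀ ζ : ℂ, ‖ζ‖ = ρ → ∀ w : ℂ, ‖w‖ ≤ ρ / 2 → ρ / 2 ≤ ‖ζ - w‖ := by
    intro ζ hζ w hw
    have := norm_sub_norm_le ζ w
    linarith
  have hint : ‖∮ ζ in C(0, ρ), g ζ / S ζ * ((ζ - z)⁻¹ - (ζ - xt)⁻¹)‖ ≤
      4 * ‖z - xt‖ / c * Q * circleGrowth b f ρ := by
    rw [circleIntegral, circleGrowth, ← intervalIntegral.integral_const_mul]
    refine intervalIntegral.norm_integral_le_of_norm_le Real.two_pi_pos.le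
      (MeasureTheory.ae_of_all _ fun θ _ => ?_) (Continuous.intervalIntegrable ?_ _ _)
    · set ζ := circleMap 0 ρ θ with hζdef
      have hζ : ‖ζ‖ = ρ := norm_circleMap_zero_of_pos hρ0 θ
      have h1 := hsub ζ hζ z hz
      have h2 := hsub ζ hζ xt hxtρ
      have hz0 : ζ - z ≠ 0 := norm_pos_iff.1 (by linarith)
      have hx0 : ζ - xt ≠ 0 := norm_pos_iff.1 (by linarith)
      have h3 : ‖(ζ - z)⁻¹ - (ζ - xt)⁻¹‖ ≤ ‖z - xt‖ / (ρ / 2 * (ρ / 2)) := by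
        rw [inv_sub_inv hz0 hx0, norm_div, norm_mul]
        have : ζ - xt - (ζ - z) = z - xt := by ring
        rw [this]
        gcongr
      have h4 : ‖g ζ / S ζ‖ ≤
          Q * ‖f ζ‖ / (c * Real.exp (Real.pi * b * |ζ.im|)) := by
        rw [norm_div]
        gcongr
        · exact (norm_nonneg _).trans (hgf ζ hζ)
        · exact hgf ζ hζ
        · exact hlow ζ hζ
      rw [deriv_circleMap, norm_smul, norm_mul, norm_mul, Complex.norm_I, mul_one, ← hζdef, hζ]
      calc ρ * (‖g ζ / S ζ‖ * ‖(ζ - z)⁻¹ - (ζ - xt)⁻¹‖)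
          ≤ ρ * (Q * ‖f ζ‖ / (c * Real.exp (Real.pi * b * |ζ.im|)) *
            (‖z - xt‖ / (ρ / 2 * (ρ / 2)))) := by
            gcongr
            exact (norm_nonneg _).trans h4
        _ = _ := by
            rw [Real.exp_neg]
            field_simp
            ring
    · have h1 := hf.continuous
      have h2 : ∀ θ, ‖circleMap 0 ρ θ‖ = ρ := norm_circleMap_zero_of_pos hρ0
      simp only [h2]
      fun_prop
  rw [hpi]
  have hnn := (norm_nonneg _).trans hint
  calc ‖S z‖ * ((2 * Real.pi)⁻¹ * _) ≤ ‖S z‖ * (4⁻¹ *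
        (4 * ‖z - xt‖ / c * Q * circleGrowth b f ρ)) := by
        gcongr
        linarith [Real.pi_gt_three]
    _ = _ := by ring

/-! ### Circles that stay away from the sequence -/

/-- Consequently an annulus thinner than the separation constant contains at most one point of each
sign. -/
lemma eq_of_abs_sub_abs_lt {x : ℤ → ℝ} (hx : IsSeparatedSeq x) {j k : ℤ}
    (hs : 0 ≤ x j ↔ 0 ≤ x k) (h : |(|x j| - |x k|)| < separationConstant x) : j = k := by
  by_contra hne
  have h1 := hx.sep_le hne
  have h2 : |(|x j| - |x k|)| = |x j - x k| := by
    rcases le_or_gt 0 (x j) with hj | hj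
    · rw [abs_of_nonneg hj, abs_of_nonneg (hs.1 hj)]
    · have hk : x k < 0 := not_le.1 fun h => absurd (hs.2 h) (not_le.2 hj)
      rw [abs_of_neg hj, abs_of_neg hk, neg_sub_neg, abs_sub_comm]
  linarith

/-- Pigeonhole on `r`, `r + η`, `r + 2η`: if each were within `η/2` of some `|x_k|`, these would be
three different points, two of them with the same sign and moduli less than `3η` apart. -/
lemma exists_radius {x : ℤ → ℝ} (hx : IsSeparatedSeq x) {η : ℝ} (hη : 0 < η)
    (hη' : 3 * η ≤ separationConstant x) (r : ℝ) :
    ∃ ρ ∈ Set.Icc r (r + 2 * η), ∀ k, η / 2 ≤ |(|x k| - ρ)| := by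
  by_contra! hcon
  obtain ⟨i, hi⟩ := hcon r ⟨le_rfl, by linarith⟩
  obtain ⟨j, hj⟩ := hcon (r + η) ⟨by linarith, by linarith⟩
  obtain ⟨k, hk⟩ := hcon (r + 2 * η) ⟨by linarith, le_rfl⟩
  rw [abs_lt] at hi hj hk
  have hij : ¬ (0 ≤ x i ↔ 0 ≤ x j) := fun h => by
    have := eq_of_abs_sub_abs_lt hx h (by rw [abs_lt]; constructor <;> linarith)
    rw [this] at hi
    linarith
  have hjk : ¬ (0 ≤ x j ↔ 0 ≤ x k) := fun h => by
    have := eq_of_abs_sub_abs_lt hx h (by rw [abs_lt]; constructor <;> linarith)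
    rw [this] at hj
    linarith
  have hik : ¬ (0 ≤ x i ↔ 0 ≤ x k) := fun h => by
    have := eq_of_abs_sub_abs_lt hx h (by rw [abs_lt]; constructor <;> linarith)
    rw [this] at hi
    linarith
  tauto

lemma IsSineTypeGenerating.exists_le_norm_of_radius {x : ℤ → ℝ} {S : ℂ → ℂ} {b : ℝ}
    (hS : IsSineTypeGenerating x S b) {η : ℝ} (hη : 0 < η) :
    ∃ c : ℝ, 0 < c ∧ ∀ ρ : ℝ, (∀ k, η / 2 ≤ |(|x k| - ρ)|) → ∀ ζ : ℂ, ‖ζ‖ = ρ →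
      c * Real.exp (Real.pi * b * |ζ.im|) ≤ ‖S ζ‖ := by
  obtain ⟨C₁, C₂, h1, -, hb⟩ := hS.bounds (η / 4) (by positivity)
  refine ⟨C₁, h1, fun ρ hρ ζ hζ => ?_⟩
  have hd : η / 4 < Metric.infDist ζ (pointSet x) := by
    refine lt_of_lt_of_le (by linarith : η / 4 < η / 2)
      ((Metric.le_infDist (pointSet_nonempty x)).2 ?_)
    rintro _ ⟨k, rfl⟩
    have h2 := abs_norm_sub_norm_le (x k : ℂ) ζ
    rw [hζ, Complex.norm_real, Real.norm_eq_abs, norm_sub_rev] at h2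
    simp only [Complex.dist_eq]
    exact (hρ k).trans h2
  have := (hb ζ hd).1
  rwa [Real.exp_neg, inv_mul_eq_div, le_div_iff₀ (Real.exp_pos _)] at this

/-! ### Convergence of the interpolation series -/

/-- In an annulus that contains at most one other point of the sequence, a single term of the
series is controlled by the growth on the two boundary circles. -/
lemma norm_mul_interpKernel_le {x : ℤ → ℝ} (hx : IsSeparatedSeq x) {S : ℂ → ℂ} {b : ℝ}
    (hS : IsSineTypeGenerating x S b) {xt : ℂ} (hxt : xt ∉ pointSet x) {f : ℂ → ℂ}
    (hf : Differentiable ℂ f) {ρ₁ ρ₂ c : ℝ} (hρ₁ : 0 < ρ₁) (hρ₁₂ : ρ₁ ≤ ρ₂) (hρ₂ : ρ₂ ≤ 2 * ρ₁)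
    (hsep : ρ₂ - ρ₁ < separationConstant x) (h₁ : ∀ k, |x k| ≠ ρ₁) (h₂ : ∀ k, |x k| ≠ ρ₂)
    (hc : 0 < c)
    (hlow₁ : ∀ ζ : ℂ, ‖ζ‖ = ρ₁ → c * Real.exp (Real.pi * b * |ζ.im|) ≤ ‖S ζ‖)
    (hlow₂ : ∀ ζ : ℂ, ‖ζ‖ = ρ₂ → c * Real.exp (Real.pi * b * |ζ.im|) ≤ ‖S ζ‖)
    {z : ℂ} (hz : ‖z‖ ≤ ρ₁ / 2) (hxtρ : ‖xt‖ ≤ ρ₁ / 2) {k : ℤ} (hk₁ : ρ₁ ≤ |x k|)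
    (hk₂ : |x k| < ρ₂) :
    ‖f (x k) * interpKernel x S xt k z‖ ≤
      ‖S z‖ * ‖z - xt‖ / c * (4 * (circleGrowth b f ρ₁ + circleGrowth b f ρ₂)) := by
  have huniq : ∀ i j, ρ₁ ≤ |x i| → |x i| < ρ₂ → ρ₁ ≤ |x j| → |x j| < ρ₂ →
      (0 ≤ x i ↔ 0 ≤ x j) → i = j := fun i j hi hi' hj hj' hs =>
    eq_of_abs_sub_abs_lt hx hs (by rw [abs_lt]; constructor <;> linarith)
  -- Here `y` is the other point of `X` in the annulus, necessarily of opposite sign to `x k`, or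
  -- `-x k` if there is none. Multiplying `f` by `ζ - y` leaves `k` as the only index contributing
  -- between the two radii.
  obtain ⟨y, hy, hky, hyj⟩ : ∃ y : ℝ, |y| ≤ ρ₂ ∧ ρ₁ ≤ |x k - y| ∧
      ∀ j, j ≠ k → ρ₁ ≤ |x j| → |x j| < ρ₂ → x j = y := by
    by_cases hex : ∃ j, j ≠ k ∧ ρ₁ ≤ |x j| ∧ |x j| < ρ₂
    · obtain ⟨j, hjk, hj₁, hj₂⟩ := hex
      have hs : ¬ (0 ≤ x j ↔ 0 ≤ x k) := fun h => hjk (huniq j k hj₁ hj₂ hk₁ hk₂ h)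
      refine ⟨x j, hj₂.le, ?_, fun i hik hi₁ hi₂ => ?_⟩
      · rcases le_or_gt 0 (x k) with h | h
        · have hj : x j < 0 := not_le.1 fun h' => hs ⟨fun _ => h, fun _ => h'⟩
          rw [abs_of_nonneg h] at hk₁
          exact le_trans (by linarith) (le_abs_self _)
        · have hj : 0 ≤ x j := by
            by_contra h'
            exact hs ⟨fun h'' => absurd h'' h', fun h'' => absurd h'' (not_le.2 h)⟩
          rw [abs_of_neg h] at hk₁
          exact le_trans (by linarith) (neg_le_abs _)
      · have hs' : ¬ (0 ≤ x i ↔ 0 ≤ x k) := fun h => hik (huniq i k hi₁ hi₂ hk₁ hk₂ h)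
        rw [huniq i j hi₁ hi₂ hj₁ hj₂ (by tauto)]
    · refine ⟨-x k, by rw [abs_neg]; exact hk₂.le, ?_, fun j hjk hj₁ hj₂ =>
        absurd ⟨j, hjk, hj₁, hj₂⟩ hex⟩
      rw [sub_neg_eq_add, ← two_mul, abs_mul, abs_two]
      linarith
  set g : ℂ → ℂ := fun ζ => f ζ * (ζ - y) with hg
  have hgd : Differentiable ℂ g := by fun_prop
  have hgf : ∀ ζ : ℂ, ‖ζ‖ ≤ ρ₂ → ‖g ζ‖ ≤ 2 * ρ₂ * ‖f ζ‖ := by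
    intro ζ hζ
    rw [hg, norm_mul, mul_comm]
    gcongr
    refine (norm_sub_le _ _).trans ?_
    rw [Complex.norm_real, Real.norm_eq_abs]
    linarith
  have e₁ := norm_sub_interpPartialSum_le hx hS hxt hf hgd hρ₁ h₁ hc hlow₁
    (fun ζ hζ => hgf ζ (hζ.trans_le hρ₁₂)) hz hxtρ
  have e₂ := norm_sub_interpPartialSum_le hx hS hxt hf hgd (hρ₁.trans_le hρ₁₂) h₂ hc hlow₂
    (fun ζ hζ => hgf ζ hζ.le) (hz.trans (by linarith)) (hxtρ.trans (by linarith))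
  rw [interpPartialSum_eq_sum hx] at e₁ e₂
  set N₁ := (hx.finite_abs_lt ρ₁).toFinset with hN₁
  set N₂ := (hx.finite_abs_lt ρ₂).toFinset with hN₂
  have hsub : N₁ ⊆ N₂ := by
    intro j hj
    simp only [hN₁, hN₂, Set.Finite.mem_toFinset, Set.mem_ofPred_eq] at hj ⊢
    linarith
  have hdiff : ∑ j ∈ N₂ \ N₁, g (x j) * interpKernel x S xt j z =
      g (x k) * interpKernel x S xt k z := by
    refine Finset.sum_eq_single k (fun j hj hjk => ?_) fun hk => absurd ?_ hk
    · simp only [hN₁, hN₂, Finset.mem_sdiff, Set.Finite.mem_toFinset, Set.mem_ofPred_eq,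
        not_lt] at hj
      simp [hg, hyj j hjk hj.2 hj.1]
    · simp only [hN₁, hN₂, Finset.mem_sdiff, Set.Finite.mem_toFinset, Set.mem_ofPred_eq, not_lt]
      exact ⟨hk₂, hk₁⟩
  have hgk : g (x k) * interpKernel x S xt k z =
      (g z - (g xt * (S z / S xt) + ∑ j ∈ N₁, g (x j) * interpKernel x S xt j z)) -
      (g z - (g xt * (S z / S xt) + ∑ j ∈ N₂, g (x j) * interpKernel x S xt j z)) := by
    rw [← hdiff, Finset.sum_sdiff_eq_sub hsub]
    ring
  have e₃ : ‖g (x k) * interpKernel x S xt k z‖ ≤ ‖S z‖ * ‖z - xt‖ / c *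
      (2 * ρ₂ * (circleGrowth b f ρ₁ + circleGrowth b f ρ₂)) := by
    rw [hgk]
    refine (norm_sub_le _ _).trans ((add_le_add e₁ e₂).trans_eq (by ring))
  have hG : 0 ≤ circleGrowth b f ρ₁ + circleGrowth b f ρ₂ :=
    add_nonneg (circleGrowth_nonneg _ _ hρ₁.le) (circleGrowth_nonneg _ _ (hρ₁.le.trans hρ₁₂))
  have e₄ : ρ₁ * ‖f (x k) * interpKernel x S xt k z‖ ≤ ‖g (x k) * interpKernel x S xt k z‖ := by
    have : ‖(x k : ℂ) - y‖ = |x k - y| := by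
      rw [← Complex.ofReal_sub, Complex.norm_real, Real.norm_eq_abs]
    have e : g (x k) * interpKernel x S xt k z =
        ((x k : ℂ) - y) * (f (x k) * interpKernel x S xt k z) := by
      rw [hg]; ring
    rw [e, norm_mul ((x k : ℂ) - y), this]
    gcongr
  -- The linear factor costs at most `2 ρ₂ ≤ 4 ρ₁` on the circles and gains at least `ρ₁` at `x k`,
  -- whence the 4.
  refine le_of_mul_le_mul_left ?_ hρ₁
  calc _ ≤ _ := e₄
    _ ≤ _ := e₃
    _ ≤ ‖S z‖ * ‖z - xt‖ / c *
      (2 * (2 * ρ₁) * (circleGrowth b f ρ₁ + circleGrowth b f ρ₂)) := by gcongr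
    _ = _ := by ring

/-- The partial sums for `r` and `ρ₁` differ by at most two terms, one per sign, each bounded with
factor 4; together with the remainder at `ρ₁` this gives `9 = 1 + 2 · 4`. -/
lemma norm_sub_interpPartialSum_le_of_annulus {x : ℤ → ℝ} (hx : IsSeparatedSeq x) {S : ℂ → ℂ}
    {b : ℝ} (hS : IsSineTypeGenerating x S b) {xt : ℂ} (hxt : xt ∉ pointSet x) {f : ℂ → ℂ}
    (hf : Differentiable ℂ f) {ρ₁ r ρ₂ c : ℝ} (hρ₁ : 0 < ρ₁) (hρ₁r : ρ₁ ≤ r) (hrρ₂ : r ≤ ρ₂)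
    (hρ₂ : ρ₂ ≤ 2 * ρ₁)
    (hsep : ρ₂ - ρ₁ < separationConstant x) (h₁ : ∀ k, |x k| ≠ ρ₁) (h₂ : ∀ k, |x k| ≠ ρ₂)
    (hc : 0 < c)
    (hlow₁ : ∀ ζ : ℂ, ‖ζ‖ = ρ₁ → c * Real.exp (Real.pi * b * |ζ.im|) ≤ ‖S ζ‖)
    (hlow₂ : ∀ ζ : ℂ, ‖ζ‖ = ρ₂ → c * Real.exp (Real.pi * b * |ζ.im|) ≤ ‖S ζ‖)
    {z : ℂ} (hz : ‖z‖ ≤ ρ₁ / 2) (hxtρ : ‖xt‖ ≤ ρ₁ / 2) :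
    ‖f z - interpPartialSum x S xt (f xt) (fun k => f (x k)) {k : ℤ | |x k| < r} z‖ ≤
      ‖S z‖ * ‖z - xt‖ / c * (9 * (circleGrowth b f ρ₁ + circleGrowth b f ρ₂)) := by
  have e₁ := norm_sub_interpPartialSum_le hx hS hxt hf hf hρ₁ h₁ hc hlow₁
    (Q := 1) (fun ζ _ => (one_mul ‖f ζ‖).ge) hz hxtρ
  rw [interpPartialSum_eq_sum hx] at e₁ ⊢
  set N₁ := (hx.finite_abs_lt ρ₁).toFinset with hN₁
  set N := (hx.finite_abs_lt r).toFinset with hN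
  have hsub : N₁ ⊆ N := by
    intro j hj
    simp only [hN₁, hN, Set.Finite.mem_toFinset, Set.mem_ofPred_eq] at hj ⊢
    linarith
  have hmem : ∀ j ∈ N \ N₁, ρ₁ ≤ |x j| ∧ |x j| < ρ₂ := by
    intro j hj
    simp only [hN₁, hN, Finset.mem_sdiff, Set.Finite.mem_toFinset, Set.mem_ofPred_eq,
      not_lt] at hj
    exact ⟨hj.2, by linarith⟩
  have hcard : (N \ N₁).card ≤ 2 := by
    classical
    have : (N \ N₁).card ≤ (Finset.univ : Finset Bool).card := by
      refine Finset.card_le_card_of_injOn (fun j => decide (0 ≤ x j))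
        (fun _ _ => Finset.mem_coe.2 (Finset.mem_univ _)) ?_
      intro i hi j hj hij
      obtain ⟨hi₁, hi₂⟩ := hmem i hi
      obtain ⟨hj₁, hj₂⟩ := hmem j hj
      exact eq_of_abs_sub_abs_lt hx (by simpa using hij)
        (by rw [abs_lt]; constructor <;> linarith)
    simpa using this
  set E := ‖S z‖ * ‖z - xt‖ / c with hE
  have hE0 : 0 ≤ E := by positivity
  have hG₁ := circleGrowth_nonneg b f hρ₁.le
  have hG₂ := circleGrowth_nonneg b f (hρ₁.le.trans (hρ₁r.trans hrρ₂))
  set G := circleGrowth b f ρ₁ + circleGrowth b f ρ₂ with hG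
  have hterm : ‖∑ j ∈ N \ N₁, f (x j) * interpKernel x S xt j z‖ ≤ 2 * (E * (4 * G)) := by
    refine (norm_sum_le_of_le _ fun j hj => norm_mul_interpKernel_le hx hS hxt hf hρ₁
      (hρ₁r.trans hrρ₂) hρ₂ hsep h₁ h₂ hc hlow₁ hlow₂ hz hxtρ (hmem j hj).1 (hmem j hj).2).trans ?_
    rw [Finset.sum_const, nsmul_eq_mul]
    have : ((N \ N₁).card : ℝ) ≤ 2 := by exact_mod_cast hcard
    gcongr
  have hsplit : f z - (f xt * (S z / S xt) + ∑ j ∈ N, f (x j) * interpKernel x S xt j z) =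
      (f z - (f xt * (S z / S xt) + ∑ j ∈ N₁, f (x j) * interpKernel x S xt j z)) -
      ∑ j ∈ N \ N₁, f (x j) * interpKernel x S xt j z := by
    rw [Finset.sum_sdiff_eq_sub hsub]
    ring
  rw [hsplit]
  calc _ ≤ _ := norm_sub_le _ _
    _ ≤ E * (1 * circleGrowth b f ρ₁) + 2 * (E * (4 * G)) := add_le_add e₁ hterm
    _ ≤ E * (1 * G) + 2 * (E * (4 * G)) := by
        gcongr
        linarith
    _ = _ := by ring

theorem tendstoUniformlyOn_interpPartialSum {x : ℤ → ℝ} (hx : IsSeparatedSeq x) {S : ℂ → ℂ}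
    {b : ℝ} (hS : IsSineTypeGenerating x S b) {xt : ℂ} (hxt : xt ∉ pointSet x) {f : ℂ → ℂ}
    (hf : f ∈ PWPlus b) {K : Set ℂ} (hK : IsCompact K) :
    TendstoUniformlyOn
      (fun (r : ℝ) (z : ℂ) =>
        interpPartialSum x S xt (f xt) (fun k => f (x k : ℂ)) {k : ℤ | |x k| < r} z)
      f atTop K := by
  obtain ⟨hfd, hlim⟩ := hf
  have hpos := hx.separationConstant_pos
  -- The two radii will lie within `2η` of `r`, so they differ by at most `4η`, half the separation
  -- constant.
  set η := separationConstant x / 8 with hη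
  have hη0 : 0 < η := by positivity
  obtain ⟨c, hc, hlow⟩ := hS.exists_le_norm_of_radius hη0
  obtain ⟨R, hR⟩ := hK.isBounded.subset_closedBall 0
  obtain ⟨B, hB⟩ := hK.exists_bound_of_continuousOn
    (f := fun z => ‖S z‖ * ‖z - xt‖ / c) (by
      have := hS.differentiable.continuous
      exact Continuous.continuousOn (by fun_prop))
  rw [Metric.tendstoUniformlyOn_iff]
  intro ε hε
  have hB0 : 0 < |B| + 1 := by positivity
  set δ := ε / (18 * (|B| + 1)) with hδ
  have hδ0 : 0 < δ := by positivity
  obtain ⟨r₀, hr₀⟩ := eventually_atTop.1 (hlim.eventually (gt_mem_nhds hδ0))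
  -- As `ρ₁ ≥ r - 2η`, these thresholds give in turn `ρ₁ ≥ r₀`, `‖z‖ ≤ ρ₁/2`, `‖xt‖ ≤ ρ₁/2`, and
  -- finally `ρ₁ > 0` with `ρ₂ ≤ 2 ρ₁`.
  filter_upwards [eventually_ge_atTop (r₀ + 2 * η), eventually_ge_atTop (2 * R + 2 * η),
    eventually_ge_atTop (2 * ‖xt‖ + 2 * η), eventually_ge_atTop (8 * η)] with r hr1 hr2 hr3 hr4
  intro z hz
  have hzR : ‖z‖ ≤ R := by simpa using hR hz
  obtain ⟨ρ₁, ⟨hρ₁, hρ₁'⟩, hg₁⟩ := exists_radius hx hη0 (by linarith) (r - 2 * η)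
  obtain ⟨ρ₂, ⟨hρ₂, hρ₂'⟩, hg₂⟩ := exists_radius hx hη0 (by linarith) r
  have hne : ∀ {ρ : ℝ}, (∀ k, η / 2 ≤ |(|x k| - ρ)|) → ∀ k, |x k| ≠ ρ := by
    intro ρ h k e
    have := h k
    rw [e, sub_self, abs_zero] at this
    linarith
  have h := norm_sub_interpPartialSum_le_of_annulus hx hS hxt hfd (ρ₁ := ρ₁) (r := r) (ρ₂ := ρ₂)
    (by linarith) (by linarith) hρ₂ (by linarith) (by linarith) (hne hg₁) (hne hg₂) hc
    (hlow ρ₁ hg₁) (hlow ρ₂ hg₂) (z := z) (by linarith) (by linarith)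
  rw [dist_eq_norm]
  have hG₁ := hr₀ ρ₁ (by linarith)
  have hG₂ := hr₀ ρ₂ (by linarith)
  have hE : ‖S z‖ * ‖z - xt‖ / c < |B| + 1 := by
    have := hB z hz
    rw [Real.norm_of_nonneg (by positivity)] at this
    linarith [le_abs_self B]
  calc _ ≤ _ := h
    _ ≤ (|B| + 1) * (9 * (circleGrowth b f ρ₁ + circleGrowth b f ρ₂)) := by
        have hn₁ := circleGrowth_nonneg b f (r := ρ₁) (by linarith)
        have hn₂ := circleGrowth_nonneg b f (r := ρ₂) (by linarith)
        gcongr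
    _ < (|B| + 1) * (9 * (δ + δ)) := by gcongr
    _ = ε := by rw [hδ]; field_simp; ring

theorem mainTheorem2 (x : ℤ → ℝ) (hx : IsSeparatedSeq x) (S : ℂ → ℂ) (b : ℝ)
    (hS : IsSineTypeGenerating x S b) (xt : ℂ) (hxt : xt ∉ pointSet x) :
    (∀ f ∈ PWPlus b, ∀ K : Set ℂ, IsCompact K →
      TendstoUniformlyOn
        (fun (r : ℝ) (z : ℂ) =>
          interpPartialSum x S xt (f xt) (fun k => f (x k : ℂ)) {k : ℤ | |x k| < r} z)
        f atTop K) ∧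
    (∃ C : ℝ, ∀ (ta : ℂ) (a : lp (fun _ : ℤ => ℂ) ⊤), ∃ f ∈ PWPlus b,
      (∀ K : Set ℂ, IsCompact K →
        TendstoUniformlyOn
          (fun (s : Finset ℤ) (z : ℂ) => interpPartialSum x S xt ta (⇑a) (↑s : Set ℤ) z)
          f atTop K) ∧
      f xt = ta ∧ (∀ k : ℤ, f (x k : ℂ) = a k) ∧
      ∀ z : ℂ, ‖f z‖ ≤
        C * max ‖a‖ ‖ta‖ * Real.exp (Real.pi * b * |z.im|) * (1 + max (Real.log ‖z‖) 0)) := by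
  exact ⟨fun _ hf _ hK => tendstoUniformlyOn_interpPartialSum hx hS hxt hf hK,
    interpolation_of_bounded hx hS hxt⟩
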